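/- Let $C_0>c>0$ and let $q_0:\mathbb R\to\mathbb R$ be measurable with $\int_0^\infty e^{C_0x}\big(|q_0(x)|+|q_0(-x)+c^2|\big)dx<\infty$. For $k=\mathrm is$, $0<s<c$, and $k_1=\sqrt{k^2+c^2}>0$ let $\phi(k,\cdot),\phi_1(k,\cdot)$ be the Jost solutions of $-y''+q_0y=k^2y$ with $\phi\sim e^{\mathrm ikx}$ as $x\to+\infty$ and $\phi_1\sim e^{-\mathrm ik_1x}$ as $x\to-\infty$, let $w=\phi_1\phi'-\phi_1'\phi$ be their Wronskian, and let $T=2\mathrm ik/w$, $T_1=2\mathrm ik_1/w$ be the transmission coefficients. For $\xi\in(-c^2/2,c^2/3)$ let $a=a(\xi)\in(0,c)$ be the unique solution of $$\int_{0}^{a}\Big(\xi+\tfrac{c^2-a^2}{2}-s^2\Big)\sqrt{\tfrac{a^2-s^2}{c^2-s^2}}\,ds=0,$$ and put (positive roots) $J(\xi)=\int_{-a}^{a}\frac{ds}{\sqrt{(c^2-s^2)(a^2-s^2)}}$, $\Gamma(\xi)=-\frac1{2J(\xi)}$, $$B(\xi)=24\int_a^c\Big(\xi+\tfrac{c^2-a^2}2-s^2\Big)\sqrt{\tfrac{s^2-a^2}{c^2-s^2}}\,ds,\qquad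 \Delta(\xi)=\frac{2}{J(\xi)}\int_a^c\frac{\log|\overline{T(\mathrm is)}T_1(\mathrm is)|}{\sqrt{(c^2-s^2)(s^2-a^2)}}\,ds,$$ $z(\xi)=\frac12\big(12\xi(c^2-a^2)+3c^4+9a^4-6a^2c^2\big)$. Let $\mathcal R(\lambda)=\sqrt{\lambda(\lambda+c^2)(\lambda+a^2)}$, with cuts along $\sigma=[-c^2,-a^2]\cup[0,\infty)$ and positive on the upper side of $[0,\infty)$, and let $\mathbb M(\xi)$ be the elliptic Riemann surface of $\mathcal R$, with upper sheet $y=\mathcal R(\lambda)$ and lower sheet $y=-\mathcal R(\lambda)$. Put $\tau(\xi)=-\int_{-c^2}^{-a^2}\frac{d\lambda}{\mathcal R}\big(\int_{-a^2}^0\frac{d\lambda}{\mathcal R}\big)^{-1}\in\mathrm i\mathbb R_+$ (on the cut $\mathcal R$ is taken on its upper side), $\theta_3(v)=\sum_{m\in\mathbb Z}e^{\pi\mathrm i(m^2\tau+2mv)}$, and, with $\xi=\frac{x}{12t}$, $$q_{\rm RH}(x,t)=\frac{\Gamma(\xi)B'(\xi)}{6\pi}\frac{d^2}{dv^2}\log\theta_3\Big(\frac{tB(\xi)+\Delta(\xi)}{2\pi}+v\Big)\Big|_{v=0}-\frac{z'(\xi)}6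 .$$ On $\mathbb M(\xi)$ let the cycle $\mathfrak b$ surround $[-c^2,-a^2]$ clockwise on the upper sheet, and let $\mathfrak a$ run along the gap from $-a^2$ to $0$ on the lower sheet and back on the upper sheet. Let $d\omega=\tilde\Gamma\,d\lambda/\mathcal R$ with $\int_{\mathfrak a}d\omega=2\pi\mathrm i$, $\tilde\tau=\int_{\mathfrak b}d\omega$, $\theta(u)=\sum_{m\in\mathbb Z}e^{\tilde\tau m^2/2+um}$, $\mathcal K=-\frac{\tilde\tau}2+\pi\mathrm i$, $h=\int_{\mathfrak a}\frac{\lambda d\lambda}{\mathcal R}\big(\int_{\mathfrak a}\frac{d\lambda}{\mathcal R}\big)^{-1}$, $d\Omega_1=\frac{\mathrm i}2\frac{\lambda-h}{\mathcal R}d\lambda$, and $d\Omega_3=-\frac{3\mathrm i}2\frac{(\lambda-\nu_1)(\lambda-\nu_2)}{\mathcal R}d\lambda$, where $\nu_1,\nu_2\in\mathbb R$ are such that $\int_{\mathfrak a}d\Omega_3=0$ and $2\nu_1+2\nu_2+c^2+a^2=0$; let $\mathrm iV=\int_{\mathfrak b}d\Omega_1$, $\mathrm iW=\int_{\mathfrak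 b}d\Omega_3$. For $p\in\mathbb M(\xi)$ with projection in $[-a^2,0]$ let $\int_{-a^2}^{p}d\omega$ be taken along the gap (so it is defined modulo $2\pi\mathrm i$), and let $A(p)=\int_\infty^pd\omega$ be taken from $\infty$ along $(-\infty,-c^2)$ on the upper sheet, along the upper side of $[-c^2,-a^2]$, and then along the gap. **Theorem.** Let $\xi\in(-c^2/2,c^2/3)$. Then $a(\xi)$ exists and is unique, $B$ and $z$ are differentiable at $\xi$, real $\nu_1,\nu_2$ as above exist, and there is exactly one point $p_0=p_0(\xi)\in\mathbb M(\xi)$ with projection in $[-a(\xi)^2,0]$ that solves the Jacobi inversion problem $$\int_{-a(\xi)^2}^{p_0}d\omega=-\mathrm i\Delta(\xi)\pmod{2\pi\mathrm i}.$$ For all real $x$ and $t\ne0$ with $\frac{x}{12t}=\xi$, the function $q_{\rm RH}$ coincides with the one-gap Its–Matveev formula for the spectrum $[-c^2,-a(\xi)^2]\cup[0,\infty)$ and the Dirichlet divisor $p_0(\xi)$: $$q_{\rm RH}(x,t)=-2\frac{d^2}{dx^2}\log\theta\big(\mathrm iVx-4\mathrm iWt-A(p_0)-\mathcal K\big)-a(\xi)^2-c^2-2h,$$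 where $\xi$ (hence $V,W,p_0,\mathcal K,\tilde\tau$) is kept fixed in the differentiation $d^2/dx^2$, and both logarithms of theta functions are twice continuously differentiable functions of the real variable ($v$, respectively $x$). -/

import Mathlib

open MeasureTheory Filter Topology Set

noncomputable section

namespace KdVShock

/-! ### Scattering data of the steplike initial profile -/

/-- `y` solves `-y'' + q y = E y` on the line in the Carathéodory sense:
`y` is differentiable and `y'` is an integral of `(q - E) y`. -/
def IsSchrodingerSolution (q : ℝ → ℝ) (E : ℂ) (y : ℝ → ℂ) : Prop :=
  Differentiable ℝ y ∧
    ∀ x : ℝ, deriv y x = deriv y 0 + ∫ u in (0 : ℝ)..x, ((q u : ℂ) - E) * y u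

/-- Right Jost solution: `-y'' + q y = k² y` and `y(x) ~ e^{ikx}` as `x → +∞`. -/
def IsJostRight (q : ℝ → ℝ) (k : ℂ) (y : ℝ → ℂ) : Prop :=
  IsSchrodingerSolution q (k ^ 2) y ∧
    Tendsto (fun x : ℝ => Complex.exp (-(Complex.I * k * x)) * y x) atTop (𝓝 1)

/-- Left Jost solution: `-y'' + q y = (k₁² - c²) y` and `y(x) ~ e^{-ik₁x}` as `x → -∞`. -/
def IsJostLeft (c : ℝ) (q : ℝ → ℝ) (k₁ : ℂ) (y : ℝ → ℂ) : Prop :=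
  IsSchrodingerSolution q (k₁ ^ 2 - (c : ℂ) ^ 2) y ∧
    Tendsto (fun x : ℝ => Complex.exp (Complex.I * k₁ * x) * y x) atBot (𝓝 1)

/-- The right Jost solution `φ(k, ·)`. -/
def jostRight (q : ℝ → ℝ) (k : ℂ) : ℝ → ℂ :=
  Classical.epsilon (IsJostRight q k)

/-- The left Jost solution `φ₁(k, ·)`, as a function of `k₁ = √(k² + c²)`. -/
def jostLeft (c : ℝ) (q : ℝ → ℝ) (k₁ : ℂ) : ℝ → ℂ :=
  Classical.epsilon (IsJostLeft c q k₁)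

/-- The (constant) Wronskian `φ₁ φ' - φ₁' φ` of the two Jost solutions, evaluated at `x = 0`. -/
def jostWronskian (c : ℝ) (q : ℝ → ℝ) (k k₁ : ℂ) : ℂ :=
  jostLeft c q k₁ 0 * deriv (jostRight q k) 0 - deriv (jostLeft c q k₁) 0 * jostRight q k 0

/-- The transmission coefficient `T(k) = 2ik / W(k)`. -/
def transT (c : ℝ) (q : ℝ → ℝ) (k k₁ : ℂ) : ℂ :=
  2 * Complex.I * k / jostWronskian c q k k₁

/-- The transmission coefficient `T₁(k) = 2ik₁ / W(k)`, where `k₁ = √(k² + c²)`. -/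
def transT₁ (c : ℝ) (q : ℝ → ℝ) (k k₁ : ℂ) : ℂ :=
  2 * Complex.I * k₁ / jostWronskian c q k k₁

/-- `log |T̄(is) T₁(is)|` for `0 < s < c`, where `k = is` and `k₁ = √(c² - s²) > 0`. -/
def logTrans (c : ℝ) (q : ℝ → ℝ) (s : ℝ) : ℝ :=
  Real.log ‖(starRingEnd ℂ) (transT c q (Complex.I * s) (Real.sqrt (c ^ 2 - s ^ 2)))
    * transT₁ c q (Complex.I * s) (Real.sqrt (c ^ 2 - s ^ 2))‖

/-! ### The branch point parameter `a(ξ)` -/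

/-- `a ∈ (0, c)` solves the equation determining `a(ξ)`. For `0 ≤ s ≤ a` the radicand
`(s² - a²)/(c² - s²)` is non-positive; the constant factor `√(-1)`, and the sign coming from
the orientation of `∫_a^0`, do not affect the vanishing of the integral. -/
def IsBranchParam (c ξ a : ℝ) : Prop :=
  0 < a ∧ a < c ∧
    ∫ s in (0 : ℝ)..a, (ξ + (c ^ 2 - a ^ 2) / 2 - s ^ 2)
      * Real.sqrt ((a ^ 2 - s ^ 2) / (c ^ 2 - s ^ 2)) = 0

/-- The function `a(ξ)`. -/
def aFun (c ξ : ℝ) : ℝ := Classical.epsilon (IsBranchParam c ξ)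

/-! ### The elliptic surface `y² = λ(λ + c²)(λ + a²)` -/

/-- The square root on `ℂ` with cut `[0, ∞)`, positive on the upper side of the cut; on the cut
itself it takes the value of the upper side. -/
def sqrtCut (z : ℂ) : ℂ :=
  if 0 ≤ z.im then z ^ (1 / 2 : ℂ) else -z ^ (1 / 2 : ℂ)

/-- `R(λ) = √(λ(λ + c²)(λ + a²))` with cuts along `σ = [-c², -a²] ∪ [0, ∞)`, positive on the
upper side of `[0, ∞)`. For real `λ` this is the boundary value `R(λ + i0)`; it is also the value
of `R` at `λ` if `λ ∉ σ`, while `R(λ - i0) = -R(λ + i0)` on `σ`. -/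
def curveR (c a : ℝ) (l : ℂ) : ℂ :=
  sqrtCut l * sqrtCut (l + (c : ℂ) ^ 2) * sqrtCut (l + (a : ℂ) ^ 2)

/-- The finite points `(λ, y)` of the surface. The point `(λ, y)`, `λ ∉ σ`, is on the upper sheet
if `y = R(λ)`, and on the lower sheet if `y = -R(λ)`. -/
def Surface (c a : ℝ) : Type :=
  {p : ℂ × ℂ // p.2 ^ 2 = p.1 * (p.1 + (c : ℂ) ^ 2) * (p.1 + (a : ℂ) ^ 2)}

/-- The projection `π(p) = λ`. -/
def Surface.proj {c a : ℝ} (p : Surface c a) : ℂ := p.1.1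

/-- `π(p)` lies in the closed gap `[-a², 0]`. -/
def Surface.InGap {c a : ℝ} (p : Surface c a) : Prop :=
  ∃ l : ℝ, l ∈ Icc (-a ^ 2) 0 ∧ p.proj = (l : ℂ)

/-- `∫_𝔞 f(λ) dλ / y`: along the gap from `-a²` to `0` on the lower sheet, and back from `0` to
`-a²` on the upper sheet. -/
def aPeriod (c a : ℝ) (f : ℂ → ℂ) : ℂ :=
  (∫ l in (-a ^ 2)..0, f (l : ℂ) / -curveR c a l) + ∫ l in (0 : ℝ)..(-a ^ 2), f (l : ℂ) / curveR c a l

/-- `∫_𝔟 f(λ) dλ / y`, where `𝔟` surrounds `[-c², -a²]` clockwise on the upper sheet: from `-c²` to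
`-a²` along the upper side of the cut, and back along its lower side, where `y = -R(λ + i0)`. -/
def bPeriod (c a : ℝ) (f : ℂ → ℂ) : ℂ :=
  (∫ l in (-c ^ 2)..(-a ^ 2), f (l : ℂ) / curveR c a l)
    + ∫ l in (-a ^ 2)..(-c ^ 2), f (l : ℂ) / -curveR c a l

/-- The normalization constant of `dω = Γ̃ dλ / y`, so that `∫_𝔞 dω = 2πi`. -/
def normConst (c a : ℝ) : ℂ := 2 * Real.pi * Complex.I * (aPeriod c a fun _ => 1)⁻¹

/-- `τ̃ = ∫_𝔟 dω`. -/
def tauTilde (c a : ℝ) : ℂ := bPeriod c a fun _ => normConst c a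

/-- The theta function `θ(z) = ∑ exp(τ̃ m² / 2 + z m)` of the surface. -/
def theta (c a : ℝ) (z : ℂ) : ℂ :=
  ∑' m : ℤ, Complex.exp (tauTilde c a * (m : ℂ) ^ 2 / 2 + z * m)

/-- The zero `h` of `dΩ₁`. -/
def hConst (c a : ℝ) : ℂ := aPeriod c a (fun l => l) * (aPeriod c a fun _ => 1)⁻¹

/-- `dΩ₁ = dOmega₁ · dλ / y`. -/
def dOmega₁ (c a : ℝ) (l : ℂ) : ℂ := Complex.I / 2 * (l - hConst c a)

/-- `dΩ₃ = dOmega₃ · dλ / y`. -/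
def dOmega₃ (ν₁ ν₂ : ℝ) (l : ℂ) : ℂ := -(3 * Complex.I / 2) * ((l - ν₁) * (l - ν₂))

/-- The conditions on the zeros `ν₁, ν₂` of `dΩ₃`. -/
def IsNuPair (c a ν₁ ν₂ : ℝ) : Prop :=
  aPeriod c a (dOmega₃ ν₁ ν₂) = 0 ∧ 2 * ν₁ + 2 * ν₂ + c ^ 2 + a ^ 2 = 0

/-- The wave number `V`, `iV = ∫_𝔟 dΩ₁`. -/
def waveNumber (c a : ℝ) : ℂ := bPeriod c a (dOmega₁ c a) / Complex.I

/-- The frequency `W`, `iW = ∫_𝔟 dΩ₃`. -/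
def frequency (c a ν₁ ν₂ : ℝ) : ℂ := bPeriod c a (dOmega₃ ν₁ ν₂) / Complex.I

open Classical in
/-- `∫_{-a²}^p dω` for `p` over the gap, integrating along the gap on the sheet containing `p`. -/
def gapIntegral {c a : ℝ} (p : Surface c a) : ℂ :=
  if p.1.2 = curveR c a p.proj then
    ∫ l in (-a ^ 2)..p.proj.re, normConst c a / curveR c a l
  else
    ∫ l in (-a ^ 2)..p.proj.re, normConst c a / -curveR c a l

/-- The Abel map `A(p) = ∫_∞^p dω` for `p` over the gap: from `∞` to `-c²` along the negative
half-axis on the upper sheet, to `-a²` along the upper side of the cut, then inside the gap. -/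
def abelMap {c a : ℝ} (p : Surface c a) : ℂ :=
  (∫ l in Iic (-c ^ 2 : ℝ), normConst c a / curveR c a l)
    + (∫ l in (-c ^ 2)..(-a ^ 2), normConst c a / curveR c a l) + gapIntegral p

/-- The Riemann constant `𝒦 = -τ̃/2 + πi`. -/
def riemannConst (c a : ℝ) : ℂ := -tauTilde c a / 2 + Real.pi * Complex.I

/-- `log θ(iVx - 4iWt - A(p₀) - 𝒦)`. -/
def logThetaIM (c a ν₁ ν₂ : ℝ) (p₀ : Surface c a) (t x : ℝ) : ℂ :=
  Complex.log (theta c a (Complex.I * waveNumber c a * x - 4 * Complex.I * frequency c a ν₁ ν₂ * t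
    - abelMap p₀ - riemannConst c a))

/-- The one-gap solution with spectrum `[-c², -a²] ∪ [0, ∞)` and initial Dirichlet divisor `p₀`,
given by the Its–Matveev formula. -/
def qIM (c a ν₁ ν₂ : ℝ) (p₀ : Surface c a) (x t : ℝ) : ℂ :=
  -2 * iteratedDeriv 2 (logThetaIM c a ν₁ ν₂ p₀ t) x - (a : ℂ) ^ 2 - (c : ℂ) ^ 2 - 2 * hConst c a

/-! ### The Riemann–Hilbert asymptotic profile -/

/-- `∫_{-a}^{a} ds / √((c² - s²)(a² - s²))`, where `a = a(ξ)`. -/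
def gapInt (c ξ : ℝ) : ℝ :=
  ∫ s in (-aFun c ξ)..(aFun c ξ), (Real.sqrt ((c ^ 2 - s ^ 2) * (aFun c ξ ^ 2 - s ^ 2)))⁻¹

/-- `B(ξ)`. -/
def phaseB (c ξ : ℝ) : ℝ :=
  24 * ∫ s in (aFun c ξ)..c, (ξ + (c ^ 2 - aFun c ξ ^ 2) / 2 - s ^ 2)
    * Real.sqrt ((s ^ 2 - aFun c ξ ^ 2) / (c ^ 2 - s ^ 2))

/-- `Γ(ξ)`. -/
def gammaRH (c ξ : ℝ) : ℝ := -(1 / 2) * (gapInt c ξ)⁻¹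

/-- `z(ξ)`. -/
def zRH (c ξ : ℝ) : ℝ :=
  (12 * ξ * (c ^ 2 - aFun c ξ ^ 2) + 3 * c ^ 4 + 9 * aFun c ξ ^ 4 - 6 * aFun c ξ ^ 2 * c ^ 2) / 2

/-- The phase shift `Δ(ξ)`. -/
def deltaRH (c : ℝ) (q₀ : ℝ → ℝ) (ξ : ℝ) : ℝ :=
  2 * (∫ s in (aFun c ξ)..c,
      logTrans c q₀ s / Real.sqrt ((c ^ 2 - s ^ 2) * (s ^ 2 - aFun c ξ ^ 2))) * (gapInt c ξ)⁻¹

/-- `τ(ξ) ∈ iℝ₊`. -/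
def tauRH (c ξ : ℝ) : ℂ :=
  -(∫ l in (-c ^ 2)..(-aFun c ξ ^ 2), 1 / curveR c (aFun c ξ) l)
    * (∫ l in (-aFun c ξ ^ 2)..0, 1 / curveR c (aFun c ξ) l)⁻¹

/-- `log θ₃((tB(ξ) + Δ(ξ))/(2π) + v | τ(ξ))`; here
`jacobiTheta₂ v τ = ∑ exp(2πi m v + πi m² τ)`. -/
def logThetaRH (c : ℝ) (q₀ : ℝ → ℝ) (ξ t v : ℝ) : ℂ :=
  Complex.log (jacobiTheta₂
    (((t * phaseB c ξ + deltaRH c q₀ ξ) / (2 * Real.pi) + v : ℝ) : ℂ) (tauRH c ξ))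

/-- The profile `q_RH(x, t)`, with `ξ = x / (12 t)`. -/
def qRH (c : ℝ) (q₀ : ℝ → ℝ) (x t : ℝ) : ℂ :=
  ((gammaRH c (x / (12 * t)) * deriv (phaseB c) (x / (12 * t)) / (6 * Real.pi) : ℝ) : ℂ)
      * iteratedDeriv 2 (logThetaRH c q₀ (x / (12 * t)) t) 0
    - ((deriv (zRH c) (x / (12 * t)) / 6 : ℝ) : ℂ)

/-- The Jacobi inversion problem for a point over the gap `[-a(ξ)², 0]`:
`∫_{-a²}^{p₀} dω = -iΔ(ξ)`, modulo `∫_𝔞 dω = 2πi` (the path may wind around the cycle `𝔞`). -/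
def SolvesJacobi (c : ℝ) (q₀ : ℝ → ℝ) (ξ : ℝ) (p₀ : Surface c (aFun c ξ)) : Prop :=
  p₀.InGap ∧ ∃ n : ℤ,
    gapIntegral p₀ = -(Complex.I * deltaRH c q₀ ξ) + 2 * Real.pi * Complex.I * n

end KdVShock

end

/-
Every period of the curve is a complete elliptic integral of the parameter `m = a²/c²`. The equation
for `a(ξ)` becomes Whitham's equation `ξ = U(m)` with `U` strictly monotone. In the variable `m` it
says that the phase is stationary in `a`, so `B'(ξ)` comes from the explicit dependence on `ξ`
alone. Legendre's relation, the Riemann bilinear relation of the curve, evaluates the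
`𝔟`-periods `iV`, `iW` and gives `12 ξ V - 4 W = B(ξ)`. Over the closed gap the real part of the
surface is a circle, which the normalized Abel map identifies with `ℝ / 2πℤ`; this solves the
Jacobi inversion problem. The Riemann constant absorbs the path from `∞` to `-a²` up to a period,
so the two theta functions have the same argument along `y ↦ V (y - x) / 2π`.
-/

open scoped Real
open MeasureTheory Filter Topology Set

noncomputable section

namespace KdVShock

/-! ### Complete elliptic integrals -/

lemma hasDerivAt_intervalIntegral_of_continuousOn {𝕜 E : Type*} [RCLike 𝕜]
    [NormedAddCommGroup E] [NormedSpace ℝ E] [NormedSpace 𝕜 E] {F F' : 𝕜 → ℝ → E} {U : Set 𝕜}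
    {a b : ℝ} {x₀ : 𝕜} (hU : U ∈ 𝓝 x₀) (hF : ∀ x ∈ U, ContinuousOn (F x) (uIcc a b))
    (hF' : ContinuousOn (Function.uncurry F') (U ×ˢ uIcc a b))
    (hd : ∀ x ∈ U, ∀ t ∈ uIcc a b, HasDerivAt (F · t) (F' x t) x) :
    HasDerivAt (fun x => ∫ t in a..b, F x t) (∫ t in a..b, F' x₀ t) x₀ := by
  obtain ⟨ε, hε, hball⟩ := Metric.nhds_basis_closedBall.mem_iff.1 hU
  obtain ⟨M, hM⟩ := ((isCompact_closedBall x₀ ε).prod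
    (isCompact_uIcc (a := a) (b := b))).exists_bound_of_continuousOn
      (hF'.mono (prod_mono hball Subset.rfl))
  have hs : Metric.closedBall x₀ ε ∈ 𝓝 x₀ := Metric.closedBall_mem_nhds x₀ hε
  have hx₀ : x₀ ∈ U := mem_of_mem_nhds hU
  have hF'₀ : ContinuousOn (F' x₀) (uIcc a b) :=
    hF'.comp (by fun_prop) fun t ht => mk_mem_prod hx₀ ht
  refine (intervalIntegral.hasDerivAt_integral_of_dominated_loc_of_deriv_le (bound := fun _ => M)
    hs ?_ (hF x₀ hx₀).intervalIntegrable ?_ ?_ intervalIntegrable_const ?_).2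
  · filter_upwards [hs] with x hx
    exact ((hF x (hball hx)).mono uIoc_subset_uIcc).aestronglyMeasurable measurableSet_uIoc
  · exact (hF'₀.mono uIoc_subset_uIcc).aestronglyMeasurable measurableSet_uIoc
  · exact .of_forall fun t ht x hx => hM (x, t) ⟨hx, uIoc_subset_uIcc ht⟩
  · exact .of_forall fun t ht x hx => hd x (hball hx) t (uIoc_subset_uIcc ht)

/-- Legendre's radical `Δ(φ) = √(1 - m sin² φ)`. -/
def ellDelta (m φ : ℝ) : ℝ := √(1 - m * Real.sin φ ^ 2)

/-- The complete elliptic integral `K` of the first kind, as a function of the parameter `m`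
(the square of the modulus). -/
def ellK (m : ℝ) : ℝ := ∫ φ in (0 : ℝ)..(π / 2), (ellDelta m φ)⁻¹

/-- The complete elliptic integral `E` of the second kind, as a function of the parameter `m`
(the square of the modulus). -/
def ellE (m : ℝ) : ℝ := ∫ φ in (0 : ℝ)..(π / 2), ellDelta m φ

lemma sin_pos_and_cos_pos {φ : ℝ} (hφ : φ ∈ Ioo 0 (π / 2)) : 0 < Real.sin φ ∧ 0 < Real.cos φ :=
  ⟨Real.sin_pos_of_pos_of_lt_pi hφ.1 (by linarith [hφ.2, Real.pi_pos]),
    Real.cos_pos_of_mem_Ioo ⟨by linarith [hφ.1, Real.pi_pos], hφ.2⟩⟩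

section

variable {m : ℝ}

lemma one_sub_mul_sin_sq_pos (hm : m < 1) (φ : ℝ) : 0 < 1 - m * Real.sin φ ^ 2 := by
  rcases (sq_nonneg (Real.sin φ)).eq_or_lt with h | h
  · simp [← h]
  · nlinarith [Real.sin_sq_le_one φ]

lemma ellDelta_pos (hm : m < 1) (φ : ℝ) : 0 < ellDelta m φ :=
  Real.sqrt_pos.2 (one_sub_mul_sin_sq_pos hm φ)

lemma ellDelta_sq (hm : m < 1) (φ : ℝ) : ellDelta m φ ^ 2 = 1 - m * Real.sin φ ^ 2 :=
  Real.sq_sqrt (one_sub_mul_sin_sq_pos hm φ).le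

lemma continuous_ellDelta (m : ℝ) : Continuous (ellDelta m) := by
  unfold ellDelta; fun_prop

lemma continuous_div_ellDelta (hm : m < 1) {g : ℝ → ℝ} (hg : Continuous g) :
    Continuous fun φ => g φ / ellDelta m φ :=
  hg.div (continuous_ellDelta m) fun φ => (ellDelta_pos hm φ).ne'

lemma continuous_inv_ellDelta (hm : m < 1) : Continuous fun φ => (ellDelta m φ)⁻¹ :=
  (continuous_ellDelta m).inv₀ fun φ => (ellDelta_pos hm φ).ne'

lemma continuousOn_uncurry_ellDelta (s : Set (ℝ × ℝ)) :
    ContinuousOn (fun p : ℝ × ℝ => ellDelta p.1 p.2) s := by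
  unfold ellDelta; fun_prop

lemma hasDerivAt_ellDelta_param (hm : m < 1) (φ : ℝ) :
    HasDerivAt (ellDelta · φ) (-Real.sin φ ^ 2 / (2 * ellDelta m φ)) m := by
  have h : HasDerivAt (fun m : ℝ => 1 - m * Real.sin φ ^ 2) (-Real.sin φ ^ 2) m := by
    simpa using ((hasDerivAt_id m).mul_const (Real.sin φ ^ 2)).const_sub 1
  exact h.sqrt (one_sub_mul_sin_sq_pos hm φ).ne'

lemma hasDerivAt_ellDelta (hm : m < 1) (φ : ℝ) :
    HasDerivAt (ellDelta m) (-(m * Real.sin φ * Real.cos φ) / ellDelta m φ) φ := by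
  have h : HasDerivAt (fun φ : ℝ => 1 - m * Real.sin φ ^ 2)
      (-(m * (2 * Real.sin φ * Real.cos φ))) φ := by
    simpa using (((Real.hasDerivAt_sin φ).pow 2).const_mul m).const_sub 1
  refine (h.sqrt (one_sub_mul_sin_sq_pos hm φ).ne').congr_deriv ?_
  rw [← ellDelta]
  field [(ellDelta_pos hm φ).ne']

lemma integral_sin_sq_div_ellDelta (hm : m < 1) :
    m * ∫ φ in (0 : ℝ)..(π / 2), Real.sin φ ^ 2 / ellDelta m φ = ellK m - ellE m := by
  unfold ellK ellE
  rw [← intervalIntegral.integral_sub ((continuous_inv_ellDelta hm).intervalIntegrable _ _)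
    ((continuous_ellDelta m).intervalIntegrable _ _), ← intervalIntegral.integral_const_mul]
  refine intervalIntegral.integral_congr fun φ _ => ?_
  have hΔ := (ellDelta_pos hm φ).ne'
  field_simp
  linear_combination ellDelta_sq hm φ

lemma integral_cos_sq_div_ellDelta (hm : m < 1) :
    m * ∫ φ in (0 : ℝ)..(π / 2), Real.cos φ ^ 2 / ellDelta m φ
      = ellE m - (1 - m) * ellK m := by
  simp_rw [Real.cos_sq', sub_div, one_div]
  rw [intervalIntegral.integral_sub ((continuous_inv_ellDelta hm).intervalIntegrable _ _)
    ((continuous_div_ellDelta hm (by fun_prop)).intervalIntegrable _ _), mul_sub,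
    integral_sin_sq_div_ellDelta hm, ← ellK]
  ring

lemma integral_quartic_div_ellDelta_eq_add (hm : m < 1) (p₀ p₁ p₂ : ℝ) :
    (∫ φ in (0 : ℝ)..(π / 2),
        (p₀ + p₁ * Real.sin φ ^ 2 + p₂ * Real.sin φ ^ 4) / ellDelta m φ)
      = p₀ * ellK m + p₁ * (∫ φ in (0 : ℝ)..(π / 2), Real.sin φ ^ 2 / ellDelta m φ)
        + p₂ * ∫ φ in (0 : ℝ)..(π / 2), Real.sin φ ^ 4 / ellDelta m φ := by
  have hintegrable (p : ℝ) (n : ℕ) :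
      IntervalIntegrable (fun φ => p * (Real.sin φ ^ n / ellDelta m φ)) volume 0 (π / 2) :=
    (continuous_const.mul (continuous_div_ellDelta hm (by fun_prop))).intervalIntegrable _ _
  have hintegrable₀ : IntervalIntegrable (fun φ => p₀ * (ellDelta m φ)⁻¹) volume 0 (π / 2) :=
    (continuous_const.mul (continuous_inv_ellDelta hm)).intervalIntegrable _ _
  simp_rw [add_div, mul_div_assoc p₁, mul_div_assoc p₂, div_eq_mul_inv p₀]
  rw [intervalIntegral.integral_add (hintegrable₀.add (hintegrable p₁ 2)) (hintegrable p₂ 4),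
    intervalIntegral.integral_add hintegrable₀ (hintegrable p₁ 2)]
  simp only [intervalIntegral.integral_const_mul, ellK]

lemma integral_sin_pow_four_div_ellDelta (hm : m < 1) :
    3 * m ^ 2 * ∫ φ in (0 : ℝ)..(π / 2), Real.sin φ ^ 4 / ellDelta m φ
      = 2 * (1 + m) * (ellK m - ellE m) - m * ellK m := by
  -- Integrate the derivative of `sin φ cos φ Δ(φ)`, which vanishes at both ends.
  have hder : ∀ φ ∈ uIcc 0 (π / 2), HasDerivAt
      (fun φ => Real.sin φ * Real.cos φ * ellDelta m φ)
      ((1 + -(2 * (1 + m)) * Real.sin φ ^ 2 + 3 * m * Real.sin φ ^ 4) / ellDelta m φ) φ := by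
    intro φ _
    refine (((Real.hasDerivAt_sin φ).mul (Real.hasDerivAt_cos φ)).mul
      (hasDerivAt_ellDelta hm φ)).congr_deriv ?_
    have hΔ := (ellDelta_pos hm φ).ne'
    simp only [Pi.mul_apply]
    field_simp
    rw [ellDelta_sq hm φ, Real.cos_sq' φ]
    ring
  have hboundary := intervalIntegral.integral_eq_sub_of_hasDerivAt hder
    ((continuous_div_ellDelta hm (by fun_prop)).intervalIntegrable _ _)
  rw [integral_quartic_div_ellDelta_eq_add hm] at hboundary
  simp only [Real.sin_zero, Real.cos_pi_div_two] at hboundary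
  linear_combination m * hboundary + 2 * (1 + m) * integral_sin_sq_div_ellDelta hm

lemma integral_inv_ellDelta_cube (hm : m < 1) :
    (1 - m) * ∫ φ in (0 : ℝ)..(π / 2), (ellDelta m φ ^ 3)⁻¹ = ellE m := by
  -- Integrate the derivative of `m sin φ cos φ / Δ(φ)`, which vanishes at both ends.
  have hder : ∀ φ ∈ uIcc 0 (π / 2), HasDerivAt
      (fun φ => m * (Real.sin φ * Real.cos φ / ellDelta m φ))
      (ellDelta m φ - (1 - m) * (ellDelta m φ ^ 3)⁻¹) φ := by
    intro φ _
    have hΔ := (ellDelta_pos hm φ).ne'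
    refine ((((Real.hasDerivAt_sin φ).mul (Real.hasDerivAt_cos φ)).div
      (hasDerivAt_ellDelta hm φ) hΔ).const_mul m).congr_deriv ?_
    have hΔ2 := ellDelta_sq hm φ
    have hΔ4 : ellDelta m φ ^ 4 = (1 - m * Real.sin φ ^ 2) ^ 2 := by rw [← hΔ2]; ring
    simp only [Pi.mul_apply]
    field_simp
    rw [hΔ2, Real.cos_sq' φ, hΔ4]
    ring
  have i0 := (continuous_ellDelta m).intervalIntegrable (μ := volume) 0 (π / 2)
  have i1 : IntervalIntegrable (fun φ => (1 - m) * (ellDelta m φ ^ 3)⁻¹) volume 0 (π / 2) :=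
    (continuous_const.mul (((continuous_ellDelta m).pow 3).inv₀
      fun φ => (pow_pos (ellDelta_pos hm φ) 3).ne')).intervalIntegrable _ _
  have hboundary := intervalIntegral.integral_eq_sub_of_hasDerivAt hder (i0.sub i1)
  rw [intervalIntegral.integral_sub i0 i1, intervalIntegral.integral_const_mul, ← ellE] at hboundary
  simp only [Real.sin_zero, Real.cos_pi_div_two] at hboundary
  linear_combination -hboundary

lemma integral_quartic_div_ellDelta (h0 : m ≠ 0) (hm : m < 1) (p₀ p₁ p₂ : ℝ) :
    (∫ φ in (0 : ℝ)..(π / 2),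
        (p₀ + p₁ * Real.sin φ ^ 2 + p₂ * Real.sin φ ^ 4) / ellDelta m φ)
      = p₀ * ellK m + p₁ * ((ellK m - ellE m) / m)
        + p₂ * ((2 * (1 + m) * (ellK m - ellE m) - m * ellK m) / (3 * m ^ 2)) := by
  rw [integral_quartic_div_ellDelta_eq_add hm, ← integral_sin_sq_div_ellDelta hm,
    mul_div_cancel_left₀ _ h0, integral_sin_sq_div_ellDelta hm,
    ← integral_sin_pow_four_div_ellDelta hm, mul_div_cancel_left₀ _ (by positivity)]

lemma hasDerivAt_ellE (h0 : m ≠ 0) (hm : m < 1) :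
    HasDerivAt ellE ((ellE m - ellK m) / (2 * m)) m := by
  have hd : HasDerivAt ellE (∫ φ in (0 : ℝ)..(π / 2), -Real.sin φ ^ 2 / (2 * ellDelta m φ)) m := by
    refine hasDerivAt_intervalIntegral_of_continuousOn (F := ellDelta)
      (F' := fun m φ => -Real.sin φ ^ 2 / (2 * ellDelta m φ)) (Iio_mem_nhds hm)
      (fun x _ => (continuous_ellDelta x).continuousOn)
      (ContinuousOn.div (by fun_prop)
        (continuousOn_const.mul (continuousOn_uncurry_ellDelta _)) ?_)
      fun x hx φ _ => hasDerivAt_ellDelta_param hx φ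
    rintro ⟨x, φ⟩ ⟨hx, -⟩
    exact (mul_pos two_pos (ellDelta_pos hx φ)).ne'
  refine hd.congr_deriv ?_
  have h : ∀ φ, -Real.sin φ ^ 2 / (2 * ellDelta m φ)
      = (-1 / 2) * (Real.sin φ ^ 2 / ellDelta m φ) := fun φ => by ring
  simp_rw [h, intervalIntegral.integral_const_mul]
  field_simp
  linear_combination -integral_sin_sq_div_ellDelta hm

lemma hasDerivAt_ellK_integral (hm : m < 1) :
    HasDerivAt ellK (∫ φ in (0 : ℝ)..(π / 2), Real.sin φ ^ 2 / (2 * ellDelta m φ ^ 3)) m := by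
  refine hasDerivAt_intervalIntegral_of_continuousOn (F := fun m φ => (ellDelta m φ)⁻¹)
    (F' := fun m φ => Real.sin φ ^ 2 / (2 * ellDelta m φ ^ 3)) (Iio_mem_nhds hm)
    (fun x hx => (continuous_inv_ellDelta hx).continuousOn)
    (ContinuousOn.div (by fun_prop)
      (continuousOn_const.mul ((continuousOn_uncurry_ellDelta _).pow 3)) ?_)
    fun x hx φ _ => ?_
  · rintro ⟨x, φ⟩ ⟨hx, -⟩
    exact (mul_pos two_pos (pow_pos (ellDelta_pos hx φ) 3)).ne'
  · have hΔ := (ellDelta_pos hx φ).ne'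
    exact ((hasDerivAt_ellDelta_param hx φ).inv hΔ).congr_deriv (by field_simp)

lemma hasDerivAt_ellK (h0 : m ≠ 0) (hm : m < 1) :
    HasDerivAt ellK ((ellE m - (1 - m) * ellK m) / (2 * m * (1 - m))) m := by
  refine (hasDerivAt_ellK_integral hm).congr_deriv ?_
  have h : ∀ φ, Real.sin φ ^ 2 / (2 * ellDelta m φ ^ 3)
      = (1 / (2 * m)) * ((ellDelta m φ ^ 3)⁻¹ - (ellDelta m φ)⁻¹) := by
    intro φ
    have hΔ := (ellDelta_pos hm φ).ne'
    field_simp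
    linear_combination ellDelta_sq hm φ
  simp_rw [h, intervalIntegral.integral_const_mul]
  rw [intervalIntegral.integral_sub _ ((continuous_inv_ellDelta hm).intervalIntegrable _ _),
    ← ellK, ← integral_inv_ellDelta_cube hm]
  · have h1m : 1 - m ≠ 0 := by linarith
    field
  · exact (((continuous_ellDelta m).pow 3).inv₀
      fun φ => (pow_pos (ellDelta_pos hm φ) 3).ne').intervalIntegrable _ _

lemma ellK_pos (hm : m < 1) : 0 < ellK m :=
  intervalIntegral.intervalIntegral_pos_of_pos_on
    ((continuous_inv_ellDelta hm).intervalIntegrable _ _)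
    (fun φ _ => inv_pos.2 (ellDelta_pos hm φ)) (by positivity)

lemma ellK_zero : ellK 0 = π / 2 := by simp [ellK, ellDelta]

lemma ellE_one : ellE 1 = 1 := by
  have h : EqOn (ellDelta 1) Real.cos (Ioo 0 (π / 2)) := fun φ hφ => by
    rw [ellDelta, one_mul, ← Real.cos_sq', Real.sqrt_sq (sin_pos_and_cos_pos hφ).2.le]
  rw [ellE, intervalIntegral.integral_congr_Ioo_of_le (by positivity) h, integral_cos]
  simp

lemma continuous_ellE : Continuous ellE := by
  unfold ellE ellDelta
  exact intervalIntegral.continuous_parametric_intervalIntegral_of_continuous' (by fun_prop) _ _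

lemma ellK_le (h0 : 0 ≤ m) (hm : m < 1) : ellK m ≤ π / 2 / √(1 - m) := by
  have h1 : 0 < √(1 - m) := Real.sqrt_pos.2 (by linarith)
  have : ellK m ≤ ∫ φ in (0 : ℝ)..(π / 2), (√(1 - m))⁻¹ := by
    refine intervalIntegral.integral_mono_on (by positivity)
      ((continuous_inv_ellDelta hm).intervalIntegrable _ _)
      intervalIntegrable_const fun φ _ => inv_anti₀ h1 (Real.sqrt_le_sqrt ?_)
    nlinarith [Real.sin_sq_le_one φ]
  simpa [div_eq_mul_inv] using this

lemma le_ellE_sub_mul_ellK (h0 : 0 ≤ m) (hm : m < 1) :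
    m * (π / 4) ≤ ellE m - (1 - m) * ellK m := by
  have h : (∫ φ in (0 : ℝ)..(π / 2), Real.cos φ ^ 2) = π / 4 := by
    rw [integral_cos_sq]; simp; ring
  rw [← integral_cos_sq_div_ellDelta hm, ← h]
  refine mul_le_mul_of_nonneg_left ?_ h0
  refine intervalIntegral.integral_mono_on (by positivity)
    (Continuous.intervalIntegrable (by fun_prop) _ _)
    ((continuous_div_ellDelta hm (by fun_prop)).intervalIntegrable _ _) fun φ _ => ?_
  rw [le_div_iff₀ (ellDelta_pos hm φ)]
  refine mul_le_of_le_one_right (sq_nonneg _) ?_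
  rw [ellDelta, Real.sqrt_le_one]
  nlinarith [sq_nonneg (Real.sin φ)]

lemma ellE_sub_mul_ellK_pos (hm : m ∈ Ioo 0 1) : 0 < ellE m - (1 - m) * ellK m :=
  (mul_pos hm.1 (by positivity)).trans_le (le_ellE_sub_mul_ellK hm.1.le hm.2)

lemma ellE_le_ellK (h0 : 0 ≤ m) (hm : m < 1) : ellE m ≤ ellK m := by
  rw [← sub_nonneg, ← integral_sin_sq_div_ellDelta hm]
  exact mul_nonneg h0 (intervalIntegral.integral_nonneg (by positivity)
    fun φ _ => div_nonneg (sq_nonneg _) (ellDelta_pos hm φ).le)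

-- The right-hand side is `3 m² ∫ cos⁴ φ / Δ(φ)`.
lemma ellK_ellE_combination_pos (hm : m ∈ Ioo 0 1) :
    0 < (1 - m) * (2 - 3 * m) * ellK m + (4 * m - 2) * ellE m := by
  have hpos : 0 < ∫ φ in (0 : ℝ)..(π / 2), Real.cos φ ^ 4 / ellDelta m φ :=
    intervalIntegral.intervalIntegral_pos_of_pos_on
      ((continuous_div_ellDelta hm.2 (by fun_prop)).intervalIntegrable _ _)
      (fun φ hφ => div_pos (pow_pos (sin_pos_and_cos_pos hφ).2 4) (ellDelta_pos hm.2 φ))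
      (by positivity)
  have h : ∀ φ, Real.cos φ ^ 4 = 1 + -2 * Real.sin φ ^ 2 + 1 * Real.sin φ ^ 4 := fun φ => by
    rw [show Real.cos φ ^ 4 = (Real.cos φ ^ 2) ^ 2 by ring, Real.cos_sq']; ring
  have hm0 := hm.1
  simp_rw [h] at hpos
  rw [integral_quartic_div_ellDelta hm0.ne' hm.2] at hpos
  have := mul_pos (show 0 < 3 * m ^ 2 by positivity) hpos
  field_simp at this
  linarith

lemma hasDerivAt_legendre (hm : m ∈ Ioo 0 1) :
    HasDerivAt (fun m => ellE (1 - m) * ellK m - (ellK m - ellE m) * ellK (1 - m)) 0 m := by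
  have h0 : m ≠ 0 := hm.1.ne'
  have h1 : 1 - m ≠ 0 := (sub_pos.2 hm.2).ne'
  have hcompl : HasDerivAt (fun x : ℝ => 1 - x) (-1) m := (hasDerivAt_id m).const_sub 1
  have hE' := (hasDerivAt_ellE h1 (by linarith [hm.1])).comp m hcompl
  have hK' := (hasDerivAt_ellK h1 (by linarith [hm.1])).comp m hcompl
  have hE := hasDerivAt_ellE h0 hm.2
  have hK := hasDerivAt_ellK h0 hm.2
  refine ((hE'.mul hK).sub ((hK.sub hE).mul hK')).congr_deriv ?_
  simp only [Function.comp, sub_sub_cancel, Pi.sub_apply]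
  field

-- `K - E ≤ m K` vanishes linearly at `0`, whereas `K(1 - m) = O(m^{-1/2})`.
lemma tendsto_ellK_sub_ellE_mul_ellK_one_sub :
    Tendsto (fun m => (ellK m - ellE m) * ellK (1 - m)) (𝓝[>] 0) (𝓝 0) := by
  have hmem : ∀ᶠ x in 𝓝[>] (0 : ℝ), x ∈ Ioo (0 : ℝ) 1 := Ioo_mem_nhdsGT zero_lt_one
  have hub : Tendsto (fun x : ℝ => x / √x * (π / 2) * ellK x) (𝓝[>] 0) (𝓝 0) := by
    have h : ContinuousAt (fun x : ℝ => √x * (π / 2) * ellK x) 0 :=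
      (Continuous.continuousAt (by fun_prop)).mul
        (hasDerivAt_ellK_integral zero_lt_one).continuousAt
    have := h.tendsto.mono_left (nhdsWithin_le_nhds (s := Ioi 0))
    simp only [Real.sqrt_zero, zero_mul] at this
    simpa only [Real.div_sqrt] using this
  refine tendsto_of_tendsto_of_tendsto_of_le_of_le' tendsto_const_nhds hub ?_ ?_
  · filter_upwards [hmem] with x hx
    exact mul_nonneg (sub_nonneg.2 (ellE_le_ellK hx.1.le hx.2))
      (ellK_pos (by linarith [hx.1])).le
  · filter_upwards [hmem] with x hx
    have hKE : ellK x - ellE x ≤ x * ellK x := by linarith [ellE_sub_mul_ellK_pos hx]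
    have hK' : ellK (1 - x) ≤ π / 2 / √x := by
      simpa only [sub_sub_cancel] using ellK_le (sub_nonneg.2 hx.2.le) (by linarith [hx.1])
    calc (ellK x - ellE x) * ellK (1 - x) ≤ x * ellK x * (π / 2 / √x) :=
          mul_le_mul hKE hK' (ellK_pos (by linarith [hx.1])).le
            (mul_nonneg hx.1.le (ellK_pos hx.2).le)
      _ = x / √x * (π / 2) * ellK x := by ring

theorem legendre_relation (hm : m ∈ Ioo 0 1) :
    ellE (1 - m) * ellK m + ellE m * ellK (1 - m) - ellK m * ellK (1 - m) = π / 2 := by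
  set L : ℝ → ℝ := fun m => ellE (1 - m) * ellK m - (ellK m - ellE m) * ellK (1 - m)
  have hconst : EqOn (fun _ => L m) L (Ioo 0 1) := fun x hx =>
    (convex_Ioo (0 : ℝ) 1).is_const_of_fderivWithin_eq_zero
      (fun y hy => (hasDerivAt_legendre hy).differentiableAt.differentiableWithinAt)
      (fun y hy => by
        rw [fderivWithin_of_isOpen isOpen_Ioo hy]
        ext; simpa using (hasDerivAt_legendre hy).deriv) hm hx
  have hlim : Tendsto L (𝓝[>] 0) (𝓝 (π / 2)) := by
    have h : ContinuousAt (fun x : ℝ => ellE (1 - x) * ellK x) 0 :=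
      (continuous_ellE.comp (by fun_prop)).continuousAt.mul
        (hasDerivAt_ellK_integral zero_lt_one).continuousAt
    have := (h.tendsto.mono_left (nhdsWithin_le_nhds (s := Ioi 0))).sub
      tendsto_ellK_sub_ellE_mul_ellK_one_sub
    simpa [ellE_one, ellK_zero] using this
  have hL : L m = π / 2 := tendsto_nhds_unique
    (tendsto_const_nhds.congr' (hconst.eventuallyEq_of_mem (Ioo_mem_nhdsGT zero_lt_one))) hlim
  linear_combination hL

end

/-! ### The modulation equation -/

/-- The self-similar speed of the modulated elliptic wave with parameter `m = a² / c²`, i.e. the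
value of `ξ / c²` at which `a(ξ)² = m c²`. -/
def whithamSpeed (m : ℝ) : ℝ :=
  (1 + m) / 6 - m * (1 - m) * ellK m / (3 * (ellE m - (1 - m) * ellK m))

section

variable {m : ℝ}

lemma eq_whithamSpeed_iff (hm : m ∈ Ioo 0 1) {x : ℝ} :
    x = whithamSpeed m ↔
      3 * (x - (1 + m) / 6) * (ellE m - (1 - m) * ellK m) + m * (1 - m) * ellK m = 0 := by
  have hD := (ellE_sub_mul_ellK_pos hm).ne'
  rw [whithamSpeed, eq_sub_iff_add_eq, ← eq_sub_iff_add_eq', div_eq_iff (by positivity)]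
  constructor <;> intro h <;> linear_combination h

lemma three_mul_sub_one_sub_two_mul_whithamSpeed_pos (hm : m ∈ Ioo 0 1) :
    0 < 3 * m - 1 - 2 * whithamSpeed m := by
  have hD := ellE_sub_mul_ellK_pos hm
  have hpos := ellK_ellE_combination_pos hm
  have : 3 * m - 1 - 2 * whithamSpeed m
      = 2 * ((1 - m) * (2 - 3 * m) * ellK m + (4 * m - 2) * ellE m)
        / (3 * (ellE m - (1 - m) * ellK m)) := by
    rw [whithamSpeed]; field
  rw [this]; positivity

lemma hasDerivAt_whithamSpeed (hm : m ∈ Ioo 0 1) :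
    HasDerivAt whithamSpeed
      (ellK m * (3 * m - 1 - 2 * whithamSpeed m) / (4 * (ellE m - (1 - m) * ellK m))) m := by
  have h0 : m ≠ 0 := hm.1.ne'
  have h1 : 1 - m ≠ 0 := (sub_pos.2 hm.2).ne'
  have hD := (ellE_sub_mul_ellK_pos hm).ne'
  have hid := hasDerivAt_id m
  have hcompl : HasDerivAt (fun m : ℝ => 1 - m) (-1) m := hid.const_sub 1
  have hK := hasDerivAt_ellK h0 hm.2
  have hnum := (hid.mul hcompl).mul hK
  have hden := ((hasDerivAt_ellE h0 hm.2).sub (hcompl.mul hK)).const_mul 3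
  refine (((hid.const_add 1).div_const 6).sub (hnum.div hden (by simpa using hD))).congr_deriv ?_
  simp only [whithamSpeed, Pi.mul_apply, Pi.sub_apply, id]
  field

lemma deriv_whithamSpeed_pos (hm : m ∈ Ioo 0 1) : 0 < deriv whithamSpeed m := by
  have hD := ellE_sub_mul_ellK_pos hm
  have hK := ellK_pos hm.2
  have hgap := three_mul_sub_one_sub_two_mul_whithamSpeed_pos hm
  rw [(hasDerivAt_whithamSpeed hm).deriv]
  positivity

lemma continuousOn_whithamSpeed : ContinuousOn whithamSpeed (Ioo 0 1) := fun _ hm =>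
  (hasDerivAt_whithamSpeed hm).continuousAt.continuousWithinAt

lemma strictMonoOn_whithamSpeed : StrictMonoOn whithamSpeed (Ioo 0 1) :=
  strictMonoOn_of_deriv_pos (convex_Ioo 0 1) continuousOn_whithamSpeed fun m hm =>
    deriv_whithamSpeed_pos (by rwa [interior_Ioo] at hm)

lemma whithamSpeed_le (hm : m ∈ Ioo 0 1) : whithamSpeed m ≤ (3 * m - 1) / 2 := by
  linarith [three_mul_sub_one_sub_two_mul_whithamSpeed_pos hm]

lemma le_whithamSpeed (hm : m ∈ Ioo 0 1) :
    (1 + m) / 6 - 2 / 3 * √(1 - m) ≤ whithamSpeed m := by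
  have hm0 := hm.1
  have hD := le_ellE_sub_mul_ellK hm0.le hm.2
  have hD' := ellE_sub_mul_ellK_pos hm
  have hs : 0 < √(1 - m) := Real.sqrt_pos.2 (sub_pos.2 hm.2)
  have hs2 : √(1 - m) ^ 2 = 1 - m := Real.sq_sqrt (sub_pos.2 hm.2).le
  have hK : (1 - m) * ellK m ≤ π / 2 * √(1 - m) :=
    calc (1 - m) * ellK m ≤ √(1 - m) ^ 2 * (π / 2 / √(1 - m)) := by
          rw [hs2]
          exact mul_le_mul_of_nonneg_left (ellK_le hm0.le hm.2) (sub_pos.2 hm.2).le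
      _ = π / 2 * √(1 - m) := by field
  have : m * (1 - m) * ellK m / (3 * (ellE m - (1 - m) * ellK m)) ≤ 2 / 3 * √(1 - m) := by
    rw [div_le_iff₀ (by positivity)]
    calc m * (1 - m) * ellK m = m * ((1 - m) * ellK m) := by ring
      _ ≤ m * (π / 2 * √(1 - m)) := by gcongr
      _ = 2 * √(1 - m) * (m * (π / 4)) := by ring
      _ ≤ 2 * √(1 - m) * (ellE m - (1 - m) * ellK m) := by gcongr
      _ = _ := by ring
  rw [whithamSpeed]; linarith

end

lemma exists_whithamSpeed_eq {x : ℝ} (hx : x ∈ Ioo (-1 / 2 : ℝ) (1 / 3)) :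
    ∃ m ∈ Ioo (0 : ℝ) 1, whithamSpeed m = x := by
  obtain ⟨m₁, hm₁, h₁⟩ : ∃ m ∈ Ioo (0 : ℝ) 1, whithamSpeed m ≤ x := by
    have hm : (x + 1 / 2) / 2 ∈ Ioo (0 : ℝ) 1 := ⟨by linarith [hx.1], by linarith [hx.2]⟩
    exact ⟨_, hm, (whithamSpeed_le hm).trans (by linarith [hx.1])⟩
  obtain ⟨m₂, hm₂, h₂⟩ : ∃ m ∈ Ioo (0 : ℝ) 1, x ≤ whithamSpeed m := by
    have hlim : Tendsto (fun m : ℝ => (1 + m) / 6 - 2 / 3 * √(1 - m)) (𝓝[<] 1) (𝓝 (1 / 3)) := by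
      have h : Continuous (fun m : ℝ => (1 + m) / 6 - 2 / 3 * √(1 - m)) := by fun_prop
      have := (h.tendsto 1).mono_left (nhdsWithin_le_nhds (s := Iio 1))
      norm_num at this
      convert this using 2
    obtain ⟨m, hlt, hm⟩ :=
      ((hlim.eventually (lt_mem_nhds hx.2)).and (Ioo_mem_nhdsLT (zero_lt_one' ℝ))).exists
    exact ⟨m, hm, hlt.le.trans (le_whithamSpeed hm)⟩
  exact isPreconnected_Ioo.intermediate_value hm₁ hm₂ continuousOn_whithamSpeed ⟨h₁, h₂⟩

/-! ### Integrals over the gap and the cut -/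

/-- `|R(λ)|` for real `λ`. -/
def absR (c a l : ℝ) : ℝ := √|l * (l + c ^ 2) * (l + a ^ 2)|

lemma absR_eq_of_abs_eq_sq {c a l r : ℝ} (hr : 0 ≤ r)
    (h : |l * (l + c ^ 2) * (l + a ^ 2)| = r ^ 2) :
    absR c a l = r := by
  rw [absR, h, Real.sqrt_sq hr]

section Moments

variable {c a m : ℝ}

lemma absR_gap_param (hc : 0 < c) (hm : m < 1) (ham : a ^ 2 = c ^ 2 * m) {φ : ℝ}
    (hφ : φ ∈ Ioo 0 (π / 2)) :
    absR c a (-(a ^ 2 * Real.sin φ ^ 2))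
      = a ^ 2 * (Real.sin φ * Real.cos φ) * (c * ellDelta m φ) := by
  obtain ⟨hs, hcos⟩ := sin_pos_and_cos_pos hφ
  have hΔ := ellDelta_pos hm φ
  refine absR_eq_of_abs_eq_sq (by positivity) ?_
  refine (congrArg abs ?_).trans ((abs_neg _).trans (abs_sq _))
  simp only [mul_pow, ellDelta_sq hm, Real.cos_sq', ham]
  ring

lemma absR_cut_param (hc : 0 < c) (hm : m ∈ Ioo 0 1) (ham : a ^ 2 = c ^ 2 * m) {φ : ℝ}
    (hφ : φ ∈ Ioo 0 (π / 2)) :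
    absR c a (-c ^ 2 + (c ^ 2 - a ^ 2) * Real.sin φ ^ 2)
      = (c ^ 2 - a ^ 2) * (Real.sin φ * Real.cos φ) * (c * ellDelta (1 - m) φ) := by
  obtain ⟨hs, hcos⟩ := sin_pos_and_cos_pos hφ
  have hm' : 1 - m < 1 := by linarith [hm.1]
  have hΔ := ellDelta_pos hm' φ
  have hca : 0 < c ^ 2 - a ^ 2 := by
    rw [ham, ← mul_one_sub]; exact mul_pos (by positivity) (sub_pos.2 hm.2)
  refine absR_eq_of_abs_eq_sq (by positivity) ?_
  refine (congrArg abs ?_).trans (abs_sq _)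
  simp only [mul_pow, ellDelta_sq hm', Real.cos_sq', ham]
  ring

lemma integral_gap_div_absR (hc : 0 < c) (ha : a ≠ 0) (hm : m < 1) (ham : a ^ 2 = c ^ 2 * m)
    (g : ℝ → ℝ) :
    ∫ l in (-a ^ 2)..0, g l / absR c a l
      = 2 / c * ∫ φ in (0 : ℝ)..(π / 2), g (-(a ^ 2 * Real.sin φ ^ 2)) / ellDelta m φ := by
  have hpi : (0 : ℝ) ≤ π / 2 := by positivity
  have hsubst := intervalIntegral.integral_comp_mul_deriv_of_deriv_nonpos (a := 0) (b := π / 2)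
    (f := fun φ => -(a ^ 2 * Real.sin φ ^ 2))
    (f' := fun φ => -(a ^ 2 * (2 * Real.sin φ * Real.cos φ)))
    (g := fun l => g l / absR c a l) (by fun_prop)
    (fun φ _ => by simpa using (((Real.hasDerivAt_sin φ).pow 2).const_mul (a ^ 2)).fun_neg)
    (fun φ hφ => by
      obtain ⟨hs, hcos⟩ := sin_pos_and_cos_pos (by simpa [hpi] using hφ)
      simp only [Left.neg_nonpos_iff]; positivity)
  simp only [Real.sin_zero, Real.sin_pi_div_two, one_pow, mul_one, ne_eq, OfNat.ofNat_ne_zero,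
    not_false_eq_true, zero_pow, mul_zero, neg_zero] at hsubst
  rw [intervalIntegral.integral_symm, ← hsubst, ← intervalIntegral.integral_neg,
    ← intervalIntegral.integral_const_mul]
  refine intervalIntegral.integral_congr_Ioo_of_le hpi fun φ hφ => ?_
  obtain ⟨hs, hcos⟩ := sin_pos_and_cos_pos hφ
  have hΔ := ellDelta_pos hm φ
  simp only [Function.comp, absR_gap_param hc hm ham hφ]
  field

lemma integral_cut_div_absR (hc : 0 < c) (hm : m ∈ Ioo 0 1) (ham : a ^ 2 = c ^ 2 * m)
    (g : ℝ → ℝ) :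
    ∫ l in (-c ^ 2)..(-a ^ 2), g l / absR c a l
      = 2 / c * ∫ φ in (0 : ℝ)..(π / 2),
          g (-c ^ 2 + (c ^ 2 - a ^ 2) * Real.sin φ ^ 2) / ellDelta (1 - m) φ := by
  have hpi : (0 : ℝ) ≤ π / 2 := by positivity
  have hca : 0 < c ^ 2 - a ^ 2 := by
    rw [ham, ← mul_one_sub]; exact mul_pos (by positivity) (sub_pos.2 hm.2)
  have hsubst := intervalIntegral.integral_comp_mul_deriv_of_deriv_nonneg (a := 0) (b := π / 2)
    (f := fun φ => -c ^ 2 + (c ^ 2 - a ^ 2) * Real.sin φ ^ 2)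
    (f' := fun φ => (c ^ 2 - a ^ 2) * (2 * Real.sin φ * Real.cos φ))
    (g := fun l => g l / absR c a l) (by fun_prop)
    (fun φ _ => by
      simpa using (((Real.hasDerivAt_sin φ).pow 2).const_mul (c ^ 2 - a ^ 2)).const_add (-c ^ 2))
    (fun φ hφ => by
      obtain ⟨hs, hcos⟩ := sin_pos_and_cos_pos (by simpa [hpi] using hφ)
      positivity)
  simp only [Real.sin_zero, Real.sin_pi_div_two, one_pow, mul_one, ne_eq, OfNat.ofNat_ne_zero,
    not_false_eq_true, zero_pow, mul_zero, add_zero, neg_add_cancel_left, sub_eq_add_neg] at hsubst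
  rw [← hsubst, ← intervalIntegral.integral_const_mul]
  refine intervalIntegral.integral_congr_Ioo_of_le hpi fun φ hφ => ?_
  obtain ⟨hs, hcos⟩ := sin_pos_and_cos_pos hφ
  have hΔ := ellDelta_pos (m := 1 - m) (by linarith [hm.1]) φ
  simp only [Function.comp, ← sub_eq_add_neg, absR_cut_param hc hm ham hφ]
  field

lemma integral_gap_quadratic_div_absR (hc : 0 < c) (hm : m ∈ Ioo 0 1) (ham : a ^ 2 = c ^ 2 * m)
    (p₀ p₁ p₂ : ℝ) :
    ∫ l in (-a ^ 2)..0, (p₀ + p₁ * l + p₂ * l ^ 2) / absR c a l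
      = p₀ * (2 / c * ellK m) - p₁ * (2 * c * (ellK m - ellE m))
        + p₂ * (2 * c ^ 3 * (2 * (1 + m) * (ellK m - ellE m) - m * ellK m) / 3) := by
  have hm0 := hm.1
  have ha : a ≠ 0 := by rintro rfl; nlinarith [mul_pos (pow_pos hc 2) hm0]
  have hquartic : ∀ φ, p₀ + p₁ * -(a ^ 2 * Real.sin φ ^ 2) + p₂ * (-(a ^ 2 * Real.sin φ ^ 2)) ^ 2
      = p₀ + -(p₁ * a ^ 2) * Real.sin φ ^ 2 + p₂ * (a ^ 2) ^ 2 * Real.sin φ ^ 4 := fun φ => by ring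
  rw [integral_gap_div_absR hc ha hm.2 ham fun l => p₀ + p₁ * l + p₂ * l ^ 2]
  simp_rw [hquartic]
  rw [integral_quartic_div_ellDelta hm0.ne' hm.2, ham]
  field

lemma integral_cut_quadratic_div_absR (hc : 0 < c) (hm : m ∈ Ioo 0 1) (ham : a ^ 2 = c ^ 2 * m)
    (p₀ p₁ p₂ : ℝ) :
    ∫ l in (-c ^ 2)..(-a ^ 2), (p₀ + p₁ * l + p₂ * l ^ 2) / absR c a l
      = p₀ * (2 / c * ellK (1 - m)) - p₁ * (2 * c * ellE (1 - m))
        + p₂ * (2 * c ^ 3 * (2 * (1 + m) * ellE (1 - m) - m * ellK (1 - m)) / 3) := by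
  have hm' : 1 - m ≠ 0 := (sub_pos.2 hm.2).ne'
  have hquartic : ∀ φ, p₀ + p₁ * (-c ^ 2 + (c ^ 2 - a ^ 2) * Real.sin φ ^ 2)
        + p₂ * (-c ^ 2 + (c ^ 2 - a ^ 2) * Real.sin φ ^ 2) ^ 2
      = (p₀ - p₁ * c ^ 2 + p₂ * c ^ 4)
        + (c ^ 2 - a ^ 2) * (p₁ - 2 * p₂ * c ^ 2) * Real.sin φ ^ 2
        + p₂ * (c ^ 2 - a ^ 2) ^ 2 * Real.sin φ ^ 4 := fun φ => by ring
  rw [integral_cut_div_absR hc hm ham fun l => p₀ + p₁ * l + p₂ * l ^ 2]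
  simp_rw [hquartic]
  rw [integral_quartic_div_ellDelta hm' (by linarith [hm.1]), ham]
  field

lemma integral_gap_inv_absR (hc : 0 < c) (hm : m ∈ Ioo 0 1) (ham : a ^ 2 = c ^ 2 * m) :
    ∫ l in (-a ^ 2)..0, (absR c a l)⁻¹ = 2 / c * ellK m := by
  simpa using integral_gap_quadratic_div_absR hc hm ham 1 0 0

lemma integral_cut_inv_absR (hc : 0 < c) (hm : m ∈ Ioo 0 1) (ham : a ^ 2 = c ^ 2 * m) :
    ∫ l in (-c ^ 2)..(-a ^ 2), (absR c a l)⁻¹ = 2 / c * ellK (1 - m) := by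
  simpa using integral_cut_quadratic_div_absR hc hm ham 1 0 0

end Moments

lemma absR_involution {c a l : ℝ} (hl : l ≠ 0) :
    absR c a (a ^ 2 * c ^ 2 / l) = a ^ 2 * c ^ 2 / l ^ 2 * absR c a l := by
  have h : a ^ 2 * c ^ 2 / l * (a ^ 2 * c ^ 2 / l + c ^ 2) * (a ^ 2 * c ^ 2 / l + a ^ 2)
      = (a ^ 2 * c ^ 2 / l ^ 2) ^ 2 * (l * (l + c ^ 2) * (l + a ^ 2)) := by field
  rw [absR, absR, h, abs_mul, abs_of_nonneg (sq_nonneg _), Real.sqrt_mul (sq_nonneg _),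
    Real.sqrt_sq (by positivity)]

/-- The involution `λ ↦ a² c² / λ` permutes the branch points and preserves `dλ / |R|`. -/
lemma integral_Iic_inv_absR {c a : ℝ} (hc : c ≠ 0) (ha : a ≠ 0) :
    ∫ l in Iic (-c ^ 2), (absR c a l)⁻¹ = ∫ l in (-a ^ 2)..0, (absR c a l)⁻¹ := by
  have hneg : ∀ l ∈ Ioo (-a ^ 2) 0, l < 0 := fun l hl => hl.2
  have himage : (fun l => a ^ 2 * c ^ 2 / l) '' Ioo (-a ^ 2) 0 = Iio (-c ^ 2) := by
    have hc2 : 0 < c ^ 2 := by positivity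
    have ha2 : 0 < a ^ 2 := by positivity
    refine Subset.antisymm (image_subset_iff.2 fun l hl => ?_) fun l (hl : l < -c ^ 2) => ?_
    · rw [mem_preimage, mem_Iio, div_lt_iff_of_neg hl.2]
      nlinarith [hl.1]
    · have hl0 : l < 0 := by linarith
      refine ⟨a ^ 2 * c ^ 2 / l, ⟨?_, div_neg_of_pos_of_neg (by positivity) hl0⟩, by field⟩
      rw [lt_div_iff_of_neg hl0]
      nlinarith
  have hderiv : ∀ l ∈ Ioo (-a ^ 2) 0, HasDerivWithinAt (fun l => a ^ 2 * c ^ 2 / l)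
      (-(a ^ 2 * c ^ 2 / l ^ 2)) (Ioo (-a ^ 2) 0) l := fun l hl => by
    refine (((hasDerivAt_inv (hneg l hl).ne).const_mul (a ^ 2 * c ^ 2)).congr_deriv
      ?_).hasDerivWithinAt
    field
  have hinj : InjOn (fun l => a ^ 2 * c ^ 2 / l) (Ioo (-a ^ 2) 0) := fun x _ y _ hxy =>
    inv_injective (mul_left_cancel₀ (by positivity) hxy)
  rw [integral_Iic_eq_integral_Iio, ← himage,
    integral_image_eq_integral_abs_deriv_smul measurableSet_Ioo hderiv hinj,
    intervalIntegral.integral_of_le (by simpa using sq_nonneg a), integral_Ioc_eq_integral_Ioo]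
  refine setIntegral_congr_fun measurableSet_Ioo fun l hl => ?_
  have hl0 : l ≠ 0 := (hneg l hl).ne
  simp only [absR_involution hl0, abs_neg, smul_eq_mul, mul_inv]
  rw [abs_of_nonneg (by positivity)]
  field

/-! ### The integrals in the variable `s`, `λ = -s²` -/

lemma integral_neg_sq_div_absR {c a u v : ℝ} (hu : 0 ≤ u) (huv : u ≤ v) (g : ℝ → ℝ) :
    ∫ l in (-v ^ 2)..(-u ^ 2), g l / absR c a l
      = 2 * ∫ s in u..v, g (-s ^ 2) / √|(c ^ 2 - s ^ 2) * (a ^ 2 - s ^ 2)| := by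
  have hsubst := intervalIntegral.integral_comp_mul_deriv_of_deriv_nonpos (a := u) (b := v)
    (f := fun s => -s ^ 2) (f' := fun s => -(2 * s)) (g := fun l => g l / absR c a l)
    (by fun_prop) (fun s _ => by simpa using (hasDerivAt_pow 2 s).fun_neg)
    (fun s hs => by
      have : u < s := by simpa [huv] using hs.1
      linarith)
  rw [intervalIntegral.integral_symm, ← hsubst, ← intervalIntegral.integral_neg,
    ← intervalIntegral.integral_const_mul]
  refine intervalIntegral.integral_congr_Ioo_of_le huv fun s hs => ?_
  have hs0 : 0 < s := hu.trans_lt hs.1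
  have habs : absR c a (-s ^ 2) = s * √|(c ^ 2 - s ^ 2) * (a ^ 2 - s ^ 2)| := by
    rw [absR, show -s ^ 2 * (-s ^ 2 + c ^ 2) * (-s ^ 2 + a ^ 2)
      = -(s ^ 2 * ((c ^ 2 - s ^ 2) * (a ^ 2 - s ^ 2))) by ring, abs_neg, abs_mul, abs_sq,
      Real.sqrt_mul (sq_nonneg s), Real.sqrt_sq hs0.le]
  simp only [Function.comp, habs]
  field

lemma sqrt_div_eq_div_sqrt_mul {x y : ℝ} (hx : 0 ≤ x) : √(x / y) = x / √(y * x) := by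
  rw [Real.sqrt_div hx, Real.sqrt_mul' _ hx, ← div_div, div_right_comm, Real.div_sqrt]

lemma intervalIntegral_comp_abs {b : ℝ} (hb : 0 ≤ b) (f : ℝ → ℝ) :
    ∫ s in (-b)..b, f |s| = 2 * ∫ s in (0 : ℝ)..b, f s := by
  have hind : (fun s => (Iio b).indicator f |s|) = (Ioo (-b) b).indicator fun s => f |s| := by
    ext s
    simp only [indicator, mem_Iio, mem_Ioo, abs_lt]
  have h := integral_comp_abs (f := (Iio b).indicator f)
  rw [hind, integral_indicator measurableSet_Ioo, setIntegral_indicator measurableSet_Iio,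
    Ioi_inter_Iio] at h
  rwa [intervalIntegral.integral_of_le (by linarith), intervalIntegral.integral_of_le hb,
    integral_Ioc_eq_integral_Ioo, integral_Ioc_eq_integral_Ioo]

section Branch

variable {c a m : ℝ}

lemma integral_branch_eq (hc : 0 < c) (ha : 0 < a) (hm : m ∈ Ioo 0 1) (ham : a ^ 2 = c ^ 2 * m)
    (ξ : ℝ) :
    3 * (∫ s in (0 : ℝ)..a,
        (ξ + (c ^ 2 - a ^ 2) / 2 - s ^ 2) * √((a ^ 2 - s ^ 2) / (c ^ 2 - s ^ 2)))
      = c * (3 * (ξ - c ^ 2 * (1 + m) / 6) * (ellE m - (1 - m) * ellK m)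
        + c ^ 2 * m * (1 - m) * ellK m) := by
  have hac : a ^ 2 < c ^ 2 := by
    rw [ham]; exact mul_lt_of_lt_one_right (by positivity) hm.2
  set κ := ξ + (c ^ 2 - a ^ 2) / 2 with hκ
  have hintegrand : EqOn (fun s => (κ - s ^ 2) * √((a ^ 2 - s ^ 2) / (c ^ 2 - s ^ 2)))
      (fun s => (κ * a ^ 2 + (κ + a ^ 2) * -s ^ 2 + 1 * (-s ^ 2) ^ 2)
        / √|(c ^ 2 - s ^ 2) * (a ^ 2 - s ^ 2)|) (Ioo 0 a) := fun s hs => by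
    have hsa : 0 < a ^ 2 - s ^ 2 := sub_pos.2 (pow_lt_pow_left₀ hs.2 hs.1.le two_ne_zero)
    have hsc : 0 < c ^ 2 - s ^ 2 := by linarith
    simp only [sqrt_div_eq_div_sqrt_mul hsa.le, abs_of_pos (mul_pos hsc hsa)]
    ring
  have hsubst := integral_neg_sq_div_absR (c := c) (a := a) le_rfl ha.le
    fun l => κ * a ^ 2 + (κ + a ^ 2) * l + 1 * l ^ 2
  rw [zero_pow two_ne_zero, neg_zero, integral_gap_quadratic_div_absR hc hm ham] at hsubst
  rw [intervalIntegral.integral_congr_Ioo_of_le ha.le hintegrand, ← mul_div_cancel_left₀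
    (∫ _ in _.._, _) (two_ne_zero' ℝ), ← hsubst, hκ, ham]
  field

lemma integral_phase_eq (hc : 0 < c) (ha : 0 < a) (hm : m ∈ Ioo 0 1) (ham : a ^ 2 = c ^ 2 * m)
    (ξ : ℝ) :
    ∫ s in a..c, (ξ + (c ^ 2 - a ^ 2) / 2 - s ^ 2) * √((s ^ 2 - a ^ 2) / (c ^ 2 - s ^ 2))
      = c * (ξ - c ^ 2 * (1 + m) / 6) * (ellE (1 - m) - m * ellK (1 - m))
        - c ^ 3 * m * (1 - m) * ellK (1 - m) / 3 := by
  have hac : a < c := by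
    refine lt_of_pow_lt_pow_left₀ 2 hc.le ?_
    rw [ham]; exact mul_lt_of_lt_one_right (by positivity) hm.2
  set κ := ξ + (c ^ 2 - a ^ 2) / 2 with hκ
  have hintegrand : EqOn (fun s => (κ - s ^ 2) * √((s ^ 2 - a ^ 2) / (c ^ 2 - s ^ 2)))
      (fun s => (-(κ * a ^ 2) + -(κ + a ^ 2) * -s ^ 2 + -1 * (-s ^ 2) ^ 2)
        / √|(c ^ 2 - s ^ 2) * (a ^ 2 - s ^ 2)|) (Ioo a c) := fun s hs => by
    have hsa : 0 < s ^ 2 - a ^ 2 := sub_pos.2 (pow_lt_pow_left₀ hs.1 ha.le two_ne_zero)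
    have hsc : 0 < c ^ 2 - s ^ 2 :=
      sub_pos.2 (pow_lt_pow_left₀ hs.2 (ha.trans hs.1).le two_ne_zero)
    have habs : |(c ^ 2 - s ^ 2) * (a ^ 2 - s ^ 2)| = (c ^ 2 - s ^ 2) * (s ^ 2 - a ^ 2) := by
      rw [abs_mul, abs_sub_comm (a ^ 2), abs_of_pos hsc, abs_of_pos hsa]
    simp only [sqrt_div_eq_div_sqrt_mul hsa.le, habs]
    ring
  have hsubst := integral_neg_sq_div_absR (c := c) (a := a) ha.le hac.le
    fun l => -(κ * a ^ 2) + -(κ + a ^ 2) * l + -1 * l ^ 2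
  rw [integral_cut_quadratic_div_absR hc hm ham] at hsubst
  rw [intervalIntegral.integral_congr_Ioo_of_le hac.le hintegrand, ← mul_div_cancel_left₀
    (∫ _ in _.._, _) (two_ne_zero' ℝ), ← hsubst, hκ, ham]
  field

lemma integral_inv_sqrt_eq (hc : 0 < c) (ha : 0 < a) (hm : m ∈ Ioo 0 1)
    (ham : a ^ 2 = c ^ 2 * m) :
    ∫ s in (-a)..a, (√((c ^ 2 - s ^ 2) * (a ^ 2 - s ^ 2)))⁻¹ = 2 / c * ellK m := by
  have hac : a ^ 2 < c ^ 2 := by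
    rw [ham]; exact mul_lt_of_lt_one_right (by positivity) hm.2
  have hintegrand : EqOn (fun s => (√((c ^ 2 - s ^ 2) * (a ^ 2 - s ^ 2)))⁻¹)
      (fun s => 1 / √|(c ^ 2 - s ^ 2) * (a ^ 2 - s ^ 2)|) (Ioo 0 a) := fun s hs => by
    have hsa : 0 < a ^ 2 - s ^ 2 := sub_pos.2 (pow_lt_pow_left₀ hs.2 hs.1.le two_ne_zero)
    have hsc : 0 < c ^ 2 - s ^ 2 := by linarith
    simp only [one_div, abs_of_pos (mul_pos hsc hsa)]
  have hsubst := integral_neg_sq_div_absR (c := c) (a := a) le_rfl ha.le fun _ => 1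
  have heven := intervalIntegral_comp_abs ha.le fun s => (√((c ^ 2 - s ^ 2) * (a ^ 2 - s ^ 2)))⁻¹
  simp only [sq_abs] at heven
  rw [heven, intervalIntegral.integral_congr_Ioo_of_le ha.le hintegrand, ← hsubst]
  simpa using integral_gap_inv_absR hc hm ham

end Branch

/-! ### The branch point and the phase as functions of `ξ` -/

section

variable {c a ξ : ℝ}

lemma sq_div_sq_mem_Ioo (ha : 0 < a) (hac : a < c) : a ^ 2 / c ^ 2 ∈ Ioo (0 : ℝ) 1 :=
  have hc : 0 < c := ha.trans hac
  ⟨by positivity, (div_lt_one (by positivity)).2 (pow_lt_pow_left₀ hac ha.le two_ne_zero)⟩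

lemma isBranchParam_iff :
    IsBranchParam c ξ a ↔ 0 < a ∧ a < c ∧ ξ = c ^ 2 * whithamSpeed (a ^ 2 / c ^ 2) := by
  unfold IsBranchParam
  refine and_congr_right fun ha => and_congr_right fun hac => ?_
  have hc : 0 < c := ha.trans hac
  have hm := sq_div_sq_mem_Ioo ha hac
  have ham : a ^ 2 = c ^ 2 * (a ^ 2 / c ^ 2) := by field
  generalize a ^ 2 / c ^ 2 = m at hm ham ⊢
  have hintegral : 3 * (∫ s in (0 : ℝ)..a, (ξ + (c ^ 2 - a ^ 2) / 2 - s ^ 2)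
      * √((a ^ 2 - s ^ 2) / (c ^ 2 - s ^ 2))) = c ^ 3 * (3 * (ξ / c ^ 2 - (1 + m) / 6)
        * (ellE m - (1 - m) * ellK m) + m * (1 - m) * ellK m) :=
    (integral_branch_eq hc ha hm ham ξ).trans (by field)
  rw [mul_comm (c ^ 2) (whithamSpeed _), ← div_eq_iff (by positivity), eq_whithamSpeed_iff hm,
    ← mul_right_inj' (three_ne_zero' ℝ), hintegral, mul_zero, mul_eq_zero,
    or_iff_right (by positivity)]

lemma existsUnique_isBranchParam (hc : 0 < c) (hξ : ξ ∈ Ioo (-c ^ 2 / 2) (c ^ 2 / 3)) :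
    ∃! a : ℝ, IsBranchParam c ξ a := by
  have hc2 : 0 < c ^ 2 := by positivity
  obtain ⟨m, hm, hmξ⟩ := exists_whithamSpeed_eq (x := ξ / c ^ 2)
    ⟨by rw [lt_div_iff₀ hc2]; linarith [hξ.1], by rw [div_lt_iff₀ hc2]; linarith [hξ.2]⟩
  have hsq : (c * √m) ^ 2 / c ^ 2 = m := by
    rw [mul_pow, Real.sq_sqrt hm.1.le, mul_div_cancel_left₀ _ hc2.ne']
  refine ⟨c * √m, isBranchParam_iff.2 ⟨mul_pos hc (Real.sqrt_pos.2 hm.1), ?_, ?_⟩, fun a ha => ?_⟩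
  · exact mul_lt_of_lt_one_right hc ((Real.sqrt_lt' one_pos).2 (by simpa using hm.2))
  · rw [hsq, hmξ]; field
  · obtain ⟨ha0, hac, haξ⟩ := isBranchParam_iff.1 ha
    have ham : a ^ 2 / c ^ 2 = m := strictMonoOn_whithamSpeed.injOn (sq_div_sq_mem_Ioo ha0 hac) hm
      (by rw [hmξ, haξ, mul_div_cancel_left₀ _ hc2.ne'])
    rw [← ham, Real.sqrt_div (sq_nonneg a), Real.sqrt_sq ha0.le, Real.sqrt_sq hc.le]
    field

lemma isBranchParam_aFun (hc : 0 < c) (hξ : ξ ∈ Ioo (-c ^ 2 / 2) (c ^ 2 / 3)) :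
    IsBranchParam c ξ (aFun c ξ) :=
  Classical.epsilon_spec (existsUnique_isBranchParam hc hξ).exists

/-- The parameter `m = a(ξ)² / c²` of the elliptic integrals that express the periods of the
surface at `ξ`. -/
def ellParam (c ξ : ℝ) : ℝ := aFun c ξ ^ 2 / c ^ 2

lemma aFun_sq (hc : c ≠ 0) : aFun c ξ ^ 2 = c ^ 2 * ellParam c ξ := by
  rw [ellParam]; field

lemma ellParam_mem_Ioo (hc : 0 < c) (hξ : ξ ∈ Ioo (-c ^ 2 / 2) (c ^ 2 / 3)) :
    ellParam c ξ ∈ Ioo 0 1 :=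
  sq_div_sq_mem_Ioo (isBranchParam_aFun hc hξ).1 (isBranchParam_aFun hc hξ).2.1

lemma mul_whithamSpeed_ellParam (hc : 0 < c) (hξ : ξ ∈ Ioo (-c ^ 2 / 2) (c ^ 2 / 3)) :
    c ^ 2 * whithamSpeed (ellParam c ξ) = ξ :=
  (isBranchParam_iff.1 (isBranchParam_aFun hc hξ)).2.2.symm

lemma modulation_equation (hc : 0 < c) (hξ : ξ ∈ Ioo (-c ^ 2 / 2) (c ^ 2 / 3)) {m : ℝ}
    (hm : ellParam c ξ = m) :
    3 * (ξ - c ^ 2 * (1 + m) / 6) * (ellE m - (1 - m) * ellK m) + c ^ 2 * m * (1 - m) * ellK m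
      = 0 := by
  subst hm
  have h := (eq_whithamSpeed_iff (ellParam_mem_Ioo hc hξ)).1 rfl
  linear_combination c ^ 2 * h - 3 * (ellE (ellParam c ξ) - (1 - ellParam c ξ)
    * ellK (ellParam c ξ)) * mul_whithamSpeed_ellParam hc hξ

lemma strictMonoOn_ellParam (hc : 0 < c) :
    StrictMonoOn (ellParam c) (Ioo (-c ^ 2 / 2) (c ^ 2 / 3)) := fun x hx y hy hxy => by
  rw [← strictMonoOn_whithamSpeed.lt_iff_lt (ellParam_mem_Ioo hc hx) (ellParam_mem_Ioo hc hy)]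
  refine lt_of_mul_lt_mul_left ?_ (sq_nonneg c)
  rwa [mul_whithamSpeed_ellParam hc hx, mul_whithamSpeed_ellParam hc hy]

lemma continuousAt_ellParam (hc : 0 < c) (hξ : ξ ∈ Ioo (-c ^ 2 / 2) (c ^ 2 / 3)) :
    ContinuousAt (ellParam c) ξ := by
  have hm := ellParam_mem_Ioo hc hξ
  refine (strictMonoOn_ellParam hc).continuousAt_of_image_mem_nhds (isOpen_Ioo.mem_nhds hξ) ?_
  have hspeed : ContinuousAt (fun m => c ^ 2 * whithamSpeed m) (ellParam c ξ) :=
    continuousAt_const.mul (hasDerivAt_whithamSpeed hm).continuousAt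
  have hnear := hspeed.preimage_mem_nhds (t := Ioo (-c ^ 2 / 2) (c ^ 2 / 3)) (by
    rw [mul_whithamSpeed_ellParam hc hξ]; exact isOpen_Ioo.mem_nhds hξ)
  filter_upwards [hnear, isOpen_Ioo.mem_nhds hm] with m hmξ hm
  exact ⟨c ^ 2 * whithamSpeed m, hmξ,
    strictMonoOn_whithamSpeed.injOn (ellParam_mem_Ioo hc hmξ) hm
      (mul_left_cancel₀ (by positivity) (mul_whithamSpeed_ellParam hc hmξ))⟩

lemma hasDerivAt_ellParam (hc : 0 < c) (hξ : ξ ∈ Ioo (-c ^ 2 / 2) (c ^ 2 / 3)) :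
    HasDerivAt (ellParam c) (c ^ 2 * deriv whithamSpeed (ellParam c ξ))⁻¹ ξ := by
  have hm := ellParam_mem_Ioo hc hξ
  have hpos := deriv_whithamSpeed_pos hm
  refine HasDerivAt.of_local_left_inverse (f := fun m => c ^ 2 * whithamSpeed m)
    (continuousAt_ellParam hc hξ) ?_ (by positivity) ?_
  · exact (hasDerivAt_whithamSpeed hm).differentiableAt.hasDerivAt.const_mul (c ^ 2)
  · filter_upwards [isOpen_Ioo.mem_nhds hξ] with y hy using mul_whithamSpeed_ellParam hc hy

lemma hasDerivAt_zRH (hc : 0 < c) (hξ : ξ ∈ Ioo (-c ^ 2 / 2) (c ^ 2 / 3)) {m : ℝ}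
    (hm : ellParam c ξ = m) :
    HasDerivAt (zRH c) (6 * c ^ 2 * (1 + m - 2 * (ellK m - ellE m) / ellK m)) ξ := by
  have hz : zRH c = fun ξ => 6 * c ^ 2 * (ξ * (1 - ellParam c ξ)) + 3 * c ^ 4 / 2
      + 9 * c ^ 4 / 2 * ellParam c ξ ^ 2 - 3 * c ^ 4 * ellParam c ξ := by
    funext ξ
    rw [zRH, aFun_sq hc.ne', show aFun c ξ ^ 4 = (aFun c ξ ^ 2) ^ 2 by ring, aFun_sq hc.ne']
    ring
  have hd := hasDerivAt_ellParam hc hξ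
  have hmem := ellParam_mem_Ioo hc hξ
  have hspeed := mul_whithamSpeed_ellParam hc hξ
  have hderiv := (((((hasDerivAt_id ξ).mul (hd.const_sub 1)).const_mul (6 * c ^ 2)).add_const
    (3 * c ^ 4 / 2)).add ((hd.fun_pow 2).const_mul (9 * c ^ 4 / 2))).sub (hd.const_mul (3 * c ^ 4))
  rw [(hasDerivAt_whithamSpeed hmem).deriv, hm] at hderiv
  rw [hm] at hmem hspeed
  have hK := (ellK_pos hmem.2).ne'
  have hgap := (three_mul_sub_one_sub_two_mul_whithamSpeed_pos hmem).ne'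
  rw [hz]
  refine hderiv.congr_deriv ?_
  simp only [id, ← hspeed, Nat.cast_ofNat, pow_one, Nat.add_one_sub_one]
  generalize whithamSpeed m = x at hgap ⊢
  obtain ⟨g, rfl⟩ : ∃ g, x = (3 * m - 1 - g) / 2 := ⟨3 * m - 1 - 2 * x, by ring⟩
  rw [show 3 * m - 1 - 2 * ((3 * m - 1 - g) / 2) = g by ring] at hgap ⊢
  field

lemma phaseB_eq (hc : 0 < c) (hξ : ξ ∈ Ioo (-c ^ 2 / 2) (c ^ 2 / 3)) {m : ℝ}
    (hm : ellParam c ξ = m) :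
    phaseB c ξ = 12 * π * c * (ξ - c ^ 2 * (1 + m) / 6) / ellK m := by
  have hmem := ellParam_mem_Ioo hc hξ
  have ham := aFun_sq (ξ := ξ) hc.ne'
  have hmod := modulation_equation hc hξ hm
  rw [hm] at hmem ham
  have hL := legendre_relation hmem
  rw [phaseB, integral_phase_eq hc (isBranchParam_aFun hc hξ).1 hmem ham,
    eq_div_iff (ellK_pos hmem.2).ne']
  linear_combination 24 * c * (ξ - c ^ 2 * (1 + m) / 6) * hL - 8 * c * ellK (1 - m) * hmod

/-- By the modulation equation the phase is stationary in the parameter `m`, so that only the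
explicit dependence on `ξ` contributes. -/
lemma hasDerivAt_phaseB (hc : 0 < c) (hξ : ξ ∈ Ioo (-c ^ 2 / 2) (c ^ 2 / 3)) {m : ℝ}
    (hm : ellParam c ξ = m) : HasDerivAt (phaseB c) (12 * π * c / ellK m) ξ := by
  have hB : phaseB c =ᶠ[𝓝 ξ] fun ξ =>
      12 * π * c * (ξ - c ^ 2 * (1 + ellParam c ξ) / 6) / ellK (ellParam c ξ) := by
    filter_upwards [isOpen_Ioo.mem_nhds hξ] with y hy using phaseB_eq hc hy rfl
  have hmem := ellParam_mem_Ioo hc hξ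
  have hmod := modulation_equation hc hξ hm
  have hK := (ellK_pos hmem.2).ne'
  have hd := hasDerivAt_ellParam hc hξ
  have hnum := ((hasDerivAt_id ξ).sub
    (((hd.const_add 1).const_mul (c ^ 2)).div_const 6)).const_mul (12 * π * c)
  have hden := (hasDerivAt_ellK hmem.1.ne' hmem.2).comp ξ hd
  refine ((hnum.div hden hK).congr_deriv ?_).congr_of_eventuallyEq hB
  simp only [hm, Function.comp, id, Pi.sub_apply] at hK hmem ⊢
  have hm0 := hmem.1.ne'
  have hm1 : 1 - m ≠ 0 := (sub_pos.2 hmem.2).ne'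
  generalize (c ^ 2 * deriv whithamSpeed m)⁻¹ = m'
  field_simp
  linear_combination -2 * m' * hmod

lemma gapInt_eq (hc : 0 < c) (hξ : ξ ∈ Ioo (-c ^ 2 / 2) (c ^ 2 / 3)) :
    gapInt c ξ = 2 / c * ellK (ellParam c ξ) :=
  integral_inv_sqrt_eq hc (isBranchParam_aFun hc hξ).1 (ellParam_mem_Ioo hc hξ) (aFun_sq hc.ne')

end

/-! ### The periods of the surface -/

lemma sqrtCut_of_nonneg {r : ℝ} (hr : 0 ≤ r) : sqrtCut r = √r := by
  rw [sqrtCut, if_pos (by simp), Real.sqrt_eq_rpow, Complex.ofReal_cpow hr]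
  norm_num

lemma sqrtCut_of_nonpos {r : ℝ} (hr : r ≤ 0) : sqrtCut r = Complex.I * √(-r) := by
  rw [sqrtCut, if_pos (by simp), Complex.ofReal_cpow_of_nonpos hr, Real.sqrt_eq_rpow,
    Complex.ofReal_cpow (neg_nonneg.2 hr), mul_comm, mul_one_div, mul_comm (π : ℂ),
    mul_div_assoc, mul_comm Complex.I, Complex.exp_pi_div_two_mul_I]
  norm_num

section CurveR

variable {c a l : ℝ}

lemma curveR_ofReal (c a l : ℝ) :
    curveR c a l = sqrtCut l * sqrtCut ↑(l + c ^ 2) * sqrtCut ↑(l + a ^ 2) := by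
  simp only [curveR, Complex.ofReal_add, Complex.ofReal_pow]

lemma absR_eq_mul_sqrt_abs (c a l : ℝ) : absR c a l = √|l| * √|l + c ^ 2| * √|l + a ^ 2| := by
  rw [absR, abs_mul, abs_mul, Real.sqrt_mul (by positivity), Real.sqrt_mul (abs_nonneg l)]

lemma curveR_gap (hac : a ^ 2 ≤ c ^ 2) (hl : l ∈ Icc (-a ^ 2) 0) :
    curveR c a l = Complex.I * absR c a l := by
  have h1 : 0 ≤ l + a ^ 2 := by linarith [hl.1]
  have h2 : 0 ≤ l + c ^ 2 := by linarith
  rw [curveR_ofReal, sqrtCut_of_nonpos hl.2, sqrtCut_of_nonneg h2, sqrtCut_of_nonneg h1,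
    absR_eq_mul_sqrt_abs, abs_of_nonpos hl.2, abs_of_nonneg h1, abs_of_nonneg h2]
  push_cast
  ring

lemma curveR_cut (hl : l ∈ Icc (-c ^ 2) (-a ^ 2)) : curveR c a l = -absR c a l := by
  have h0 : l ≤ 0 := hl.2.trans (neg_nonpos.2 (sq_nonneg a))
  have h1 : l + a ^ 2 ≤ 0 := by linarith [hl.2]
  have h2 : 0 ≤ l + c ^ 2 := by linarith [hl.1]
  rw [curveR_ofReal, sqrtCut_of_nonpos h0, sqrtCut_of_nonneg h2, sqrtCut_of_nonpos h1,
    absR_eq_mul_sqrt_abs, abs_of_nonpos h0, abs_of_nonpos h1, abs_of_nonneg h2]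
  push_cast
  linear_combination (√(-l) * √(l + c ^ 2) * √(-(l + a ^ 2)) : ℂ) * Complex.I_sq

lemma curveR_left (hac : a ^ 2 ≤ c ^ 2) (hl : l ≤ -c ^ 2) :
    curveR c a l = -(Complex.I * absR c a l) := by
  have h0 : l ≤ 0 := hl.trans (neg_nonpos.2 (sq_nonneg c))
  have h1 : l + a ^ 2 ≤ 0 := by linarith
  have h2 : l + c ^ 2 ≤ 0 := by linarith
  rw [curveR_ofReal, sqrtCut_of_nonpos h0, sqrtCut_of_nonpos h2, sqrtCut_of_nonpos h1,
    absR_eq_mul_sqrt_abs, abs_of_nonpos h0, abs_of_nonpos h1, abs_of_nonpos h2]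
  push_cast
  linear_combination (Complex.I * √(-l) * √(-(l + c ^ 2)) * √(-(l + a ^ 2)) : ℂ) * Complex.I_sq

lemma neg_sq_nonpos (a : ℝ) : -a ^ 2 ≤ 0 := neg_nonpos.2 (sq_nonneg a)

variable {f : ℂ → ℂ} {k : ℂ} {g : ℝ → ℝ}

lemma integral_div_curveR_gap (hac : a ^ 2 ≤ c ^ 2) (hf : ∀ l : ℝ, f l = k * g l)
    (hl : l ∈ Icc (-a ^ 2) 0) :
    ∫ u in (-a ^ 2)..l, f (u : ℂ) / curveR c a u
      = -(Complex.I * k * (∫ u in (-a ^ 2)..l, g u / absR c a u : ℝ)) := by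
  rw [← intervalIntegral.integral_ofReal, ← intervalIntegral.integral_const_mul,
    ← intervalIntegral.integral_neg]
  refine intervalIntegral.integral_congr fun u hu => ?_
  rw [uIcc_of_le hl.1] at hu
  rw [hf, curveR_gap hac ⟨hu.1, hu.2.trans hl.2⟩, div_mul_eq_div_div_swap, Complex.div_I]
  push_cast
  ring

lemma integral_div_curveR_cut (hac : a ^ 2 ≤ c ^ 2) (hf : ∀ l : ℝ, f l = k * g l) :
    ∫ u in (-c ^ 2)..(-a ^ 2), f (u : ℂ) / curveR c a u
      = -(k * (∫ u in (-c ^ 2)..(-a ^ 2), g u / absR c a u : ℝ)) := by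
  rw [← intervalIntegral.integral_ofReal, ← intervalIntegral.integral_const_mul,
    ← intervalIntegral.integral_neg]
  refine intervalIntegral.integral_congr fun u hu => ?_
  rw [uIcc_of_le (neg_le_neg hac)] at hu
  rw [hf, curveR_cut hu]
  push_cast
  ring

lemma aPeriod_eq (hac : a ^ 2 ≤ c ^ 2) (hf : ∀ l : ℝ, f l = k * g l) :
    aPeriod c a f = 2 * Complex.I * k * (∫ l in (-a ^ 2)..0, g l / absR c a l : ℝ) := by
  have hgap := integral_div_curveR_gap hac hf (right_mem_Icc.2 (neg_sq_nonpos a))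
  simp only [aPeriod, div_neg, intervalIntegral.integral_neg,
    intervalIntegral.integral_symm (-a ^ 2) 0, hgap]
  ring

lemma bPeriod_eq (hac : a ^ 2 ≤ c ^ 2) (hf : ∀ l : ℝ, f l = k * g l) :
    bPeriod c a f = -(2 * k * (∫ l in (-c ^ 2)..(-a ^ 2), g l / absR c a l : ℝ)) := by
  simp only [bPeriod, div_neg, intervalIntegral.integral_neg,
    intervalIntegral.integral_symm (-c ^ 2) (-a ^ 2), integral_div_curveR_cut hac hf]
  ring

end CurveR

section Periods

variable {c a m : ℝ}

lemma sq_le_sq_of_eq_mul (hm : m ≤ 1) (ham : a ^ 2 = c ^ 2 * m) : a ^ 2 ≤ c ^ 2 :=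
  ham.trans_le (mul_le_of_le_one_right (sq_nonneg c) hm)

lemma ofReal_ellK_ne_zero (hm : m < 1) : (ellK m : ℂ) ≠ 0 :=
  Complex.ofReal_ne_zero.2 (ellK_pos hm).ne'

lemma aPeriod_one (hc : 0 < c) (hm : m ∈ Ioo 0 1) (ham : a ^ 2 = c ^ 2 * m) :
    aPeriod c a (fun _ => 1) = 4 * Complex.I / c * ellK m := by
  rw [aPeriod_eq (sq_le_sq_of_eq_mul hm.2.le ham) (k := 1) (g := fun _ => 1) (by simp)]
  simp only [one_div, integral_gap_inv_absR hc hm ham]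
  push_cast
  ring

lemma normConst_eq (hc : 0 < c) (hm : m ∈ Ioo 0 1) (ham : a ^ 2 = c ^ 2 * m) :
    normConst c a = π * c / (2 * ellK m) := by
  have hK := ofReal_ellK_ne_zero hm.2
  have hc' : (c : ℂ) ≠ 0 := Complex.ofReal_ne_zero.2 hc.ne'
  rw [normConst, aPeriod_one hc hm ham]
  field

lemma hConst_eq (hc : 0 < c) (hm : m ∈ Ioo 0 1) (ham : a ^ 2 = c ^ 2 * m) :
    hConst c a = (-(c ^ 2 * (ellK m - ellE m) / ellK m) : ℝ) := by
  have hK := ofReal_ellK_ne_zero hm.2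
  have hc' : (c : ℂ) ≠ 0 := Complex.ofReal_ne_zero.2 hc.ne'
  rw [hConst, aPeriod_one hc hm ham, aPeriod_eq (sq_le_sq_of_eq_mul hm.2.le ham) (k := 1)
    (g := fun l => 0 + 1 * l + 0 * l ^ 2) (by simp), integral_gap_quadratic_div_absR hc hm ham]
  push_cast
  field

lemma waveNumber_eq (hc : 0 < c) (hm : m ∈ Ioo 0 1) (ham : a ^ 2 = c ^ 2 * m) :
    waveNumber c a = (π * c / ellK m : ℝ) := by
  have hK := (ellK_pos hm.2).ne'
  have hL := legendre_relation hm
  have hform : ∀ l : ℝ, dOmega₁ c a l = Complex.I / 2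
      * ((c ^ 2 * (ellK m - ellE m) / ellK m + 1 * l + 0 * l ^ 2 : ℝ) : ℂ) := fun l => by
    rw [dOmega₁, hConst_eq hc hm ham]
    push_cast
    ring
  rw [waveNumber, bPeriod_eq (sq_le_sq_of_eq_mul hm.2.le ham) hform,
    integral_cut_quadratic_div_absR hc hm ham, div_eq_iff Complex.I_ne_zero,
    mul_div_cancel₀ _ two_ne_zero, mul_comm Complex.I, ← neg_mul, ← Complex.ofReal_neg]
  congr 2
  field_simp
  linear_combination 6 * hL

lemma dOmega₃_ofReal (ν₁ ν₂ l : ℝ) : dOmega₃ ν₁ ν₂ l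
    = -(3 * Complex.I / 2) * ((ν₁ * ν₂ + -(ν₁ + ν₂) * l + 1 * l ^ 2 : ℝ) : ℂ) := by
  rw [dOmega₃]
  push_cast
  ring

lemma isNuPair_iff (hc : 0 < c) (hm : m ∈ Ioo 0 1) (ham : a ^ 2 = c ^ 2 * m) {ν₁ ν₂ : ℝ} :
    IsNuPair c a ν₁ ν₂ ↔
      ν₁ * ν₂ = c ^ 4 * (m / 3 - (1 + m) * (ellK m - ellE m) / (6 * ellK m)) ∧
        ν₁ + ν₂ = -(c ^ 2 * (1 + m) / 2) := by
  have hK := ellK_pos hm.2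
  have hsum : 2 * ν₁ + 2 * ν₂ + c ^ 2 + a ^ 2 = 0 ↔ ν₁ + ν₂ = -(c ^ 2 * (1 + m) / 2) := by
    constructor <;> intro h <;> linarith
  rw [IsNuPair, hsum]
  refine and_congr_left fun hν => ?_
  have hgap : ν₁ * ν₂ * (2 / c * ellK m) - -(-(c ^ 2 * (1 + m) / 2)) * (2 * c * (ellK m - ellE m))
      + 1 * (2 * c ^ 3 * (2 * (1 + m) * (ellK m - ellE m) - m * ellK m) / 3)
      = 2 / c * ellK m
        * (ν₁ * ν₂ - c ^ 4 * (m / 3 - (1 + m) * (ellK m - ellE m) / (6 * ellK m))) := by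
    field
  rw [aPeriod_eq (sq_le_sq_of_eq_mul hm.2.le ham) (dOmega₃_ofReal ν₁ ν₂),
    integral_gap_quadratic_div_absR hc hm ham, hν, mul_eq_zero, or_iff_right (by simp),
    Complex.ofReal_eq_zero, hgap, mul_eq_zero, or_iff_right (by positivity), sub_eq_zero]

/-- The zeros are real because the perfect square `(λ + (c² + a²)/4)²` has a nonnegative integral
over the gap, which says that the discriminant is nonnegative. -/
lemma exists_isNuPair (hc : 0 < c) (hm : m ∈ Ioo 0 1) (ham : a ^ 2 = c ^ 2 * m) :
    ∃ ν₁ ν₂ : ℝ, IsNuPair c a ν₁ ν₂ := by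
  have hK := ellK_pos hm.2
  set p := c ^ 4 * (m / 3 - (1 + m) * (ellK m - ellE m) / (6 * ellK m)) with hp
  set s := c ^ 2 * (1 + m) / 4 with hs
  have hsquare : 0 ≤ ∫ l in (-a ^ 2)..0, (s ^ 2 + 2 * s * l + 1 * l ^ 2) / absR c a l := by
    refine intervalIntegral.integral_nonneg (neg_sq_nonpos a) fun l _ => ?_
    rw [one_mul, ← add_sq]
    exact div_nonneg (sq_nonneg _) (Real.sqrt_nonneg _)
  have hdisc : 0 ≤ s ^ 2 - p := by
    refine (mul_nonneg_iff_of_pos_left (show 0 < 2 / c * ellK m by positivity)).1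
      (hsquare.trans_eq ?_)
    rw [integral_gap_quadratic_div_absR hc hm ham, hp, hs]
    field
  refine ⟨-s + √(s ^ 2 - p), -s - √(s ^ 2 - p), (isNuPair_iff hc hm ham).2 ⟨?_, by ring⟩⟩
  linear_combination -Real.sq_sqrt hdisc

lemma frequency_eq (hc : 0 < c) (hm : m ∈ Ioo 0 1) (ham : a ^ 2 = c ^ 2 * m) {ν₁ ν₂ : ℝ}
    (hν : IsNuPair c a ν₁ ν₂) :
    frequency c a ν₁ ν₂ = (π * c ^ 3 * (1 + m) / (2 * ellK m) : ℝ) := by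
  obtain ⟨hprod, hsum⟩ := (isNuPair_iff hc hm ham).1 hν
  have hK := (ellK_pos hm.2).ne'
  have hL := legendre_relation hm
  have hI (r : ℂ) : -(2 * -(3 * Complex.I / 2) * r) / Complex.I = 3 * r := by
    rw [div_eq_iff Complex.I_ne_zero]
    ring
  rw [frequency, bPeriod_eq (sq_le_sq_of_eq_mul hm.2.le ham) (dOmega₃_ofReal ν₁ ν₂),
    integral_cut_quadratic_div_absR hc hm ham, hsum, hprod, hI, ← Complex.ofReal_ofNat,
    ← Complex.ofReal_mul]
  congr 1
  field_simp
  linear_combination 12 * (1 + m) * hL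

lemma tauTilde_eq (hc : 0 < c) (hm : m ∈ Ioo 0 1) (ham : a ^ 2 = c ^ 2 * m) :
    tauTilde c a = -(2 * π * (ellK (1 - m) / ellK m)) := by
  have hK := ofReal_ellK_ne_zero hm.2
  have hc' : (c : ℂ) ≠ 0 := Complex.ofReal_ne_zero.2 hc.ne'
  rw [tauTilde, bPeriod_eq (sq_le_sq_of_eq_mul hm.2.le ham) (k := normConst c a)
    (g := fun _ => 1) (by simp), normConst_eq hc hm ham]
  simp only [one_div, integral_cut_inv_absR hc hm ham]
  push_cast
  field

lemma tauRH_eq {ξ : ℝ} (hc : 0 < c) (hm : m ∈ Ioo 0 1) (ham : aFun c ξ ^ 2 = c ^ 2 * m) :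
    tauRH c ξ = Complex.I * (ellK (1 - m) / ellK m : ℝ) := by
  have hK := ofReal_ellK_ne_zero hm.2
  have hc' : (c : ℂ) ≠ 0 := Complex.ofReal_ne_zero.2 hc.ne'
  have hac := sq_le_sq_of_eq_mul hm.2.le ham
  rw [tauRH, integral_div_curveR_cut hac (f := fun _ => 1) (k := 1) (g := fun _ => 1) (by simp),
    integral_div_curveR_gap hac (f := fun _ => 1) (k := 1) (g := fun _ => 1) (by simp)
      (right_mem_Icc.2 (neg_sq_nonpos _))]
  simp only [one_div, integral_cut_inv_absR hc hm ham, integral_gap_inv_absR hc hm ham]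
  push_cast
  field_simp
  linear_combination (-ellK (1 - m) : ℂ) * Complex.I_sq

lemma abelMap_add_riemannConst (hc : 0 < c) (hm : m ∈ Ioo 0 1) (ham : a ^ 2 = c ^ 2 * m)
    (p : Surface c a) :
    abelMap p + riemannConst c a = 2 * π * Complex.I + gapIntegral p := by
  have hK := ofReal_ellK_ne_zero hm.2
  have hc' : (c : ℂ) ≠ 0 := Complex.ofReal_ne_zero.2 hc.ne'
  have ha : a ≠ 0 := by
    rintro rfl
    exact (mul_pos (pow_pos hc 2) hm.1).ne (by simpa using ham)
  have hac := sq_le_sq_of_eq_mul hm.2.le ham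
  have hleft : ∫ l in Iic (-c ^ 2 : ℝ), normConst c a / curveR c a l
      = normConst c a * Complex.I * (2 / c * ellK m : ℝ) := by
    rw [← integral_gap_inv_absR hc hm ham, ← integral_Iic_inv_absR hc.ne' ha,
      ← integral_complex_ofReal, ← integral_const_mul]
    refine setIntegral_congr_fun measurableSet_Iic fun l hl => ?_
    rw [curveR_left hac hl, div_neg, div_mul_eq_div_div_swap, Complex.div_I]
    push_cast
    ring
  have hcut := integral_div_curveR_cut hac (f := fun _ => normConst c a)
    (k := normConst c a) (g := fun _ => 1) (by simp)
  simp only [one_div, integral_cut_inv_absR hc hm ham] at hcut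
  rw [abelMap, riemannConst, hleft, hcut, tauTilde_eq hc hm ham, normConst_eq hc hm ham]
  push_cast
  field

end Periods

/-! ### Theta functions -/

lemma exists_pos_jacobiTheta₂_I_mul {s : ℝ} (hs : 0 < s) (y : ℝ) :
    ∃ r : ℝ, 0 < r ∧ jacobiTheta₂ (Complex.I * y) (Complex.I * s) = r := by
  have hterm (n : ℤ) : jacobiTheta₂_term n (Complex.I * y) (Complex.I * s)
      = (Real.exp (-(2 * π * n * y + π * n ^ 2 * s)) : ℝ) := by
    rw [jacobiTheta₂_term, Complex.ofReal_exp]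
    congr 1
    push_cast
    linear_combination (2 * π * n * y + π * n ^ 2 * s : ℂ) * Complex.I_sq
  have hsum :=
    (summable_jacobiTheta₂_term_iff (Complex.I * y) (Complex.I * s)).2 (by simpa using hs)
  simp_rw [hterm] at hsum
  refine ⟨_, (Complex.summable_ofReal.1 hsum).tsum_pos (fun n => (Real.exp_pos _).le) 0
    (Real.exp_pos _), ?_⟩
  rw [jacobiTheta₂, tsum_congr hterm, Complex.ofReal_tsum]

/-- The functional equation exchanges the real axis with the imaginary one, where all terms of the
theta series are positive. -/
lemma exists_pos_jacobiTheta₂_ofReal {t : ℝ} (ht : 0 < t) (v : ℝ) :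
    ∃ r : ℝ, 0 < r ∧ jacobiTheta₂ v (Complex.I * t) = r := by
  obtain ⟨r, hr, h⟩ := exists_pos_jacobiTheta₂_I_mul (inv_pos.2 ht) (-(v / t))
  have htc : (t : ℂ) ≠ 0 := Complex.ofReal_ne_zero.2 ht.ne'
  have hv : (v : ℂ) / (Complex.I * t) = Complex.I * (-(v / t) : ℝ) := by
    rw [div_mul_eq_div_div, Complex.div_I]
    push_cast
    ring
  have hτ : -1 / (Complex.I * t) = Complex.I * (t⁻¹ : ℝ) := by
    rw [div_mul_eq_div_div, Complex.div_I]
    push_cast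
    ring
  have hbase : -Complex.I * (Complex.I * t) = t := by
    linear_combination (-t : ℂ) * Complex.I_sq
  have hexp : -π * Complex.I * v ^ 2 / (Complex.I * t) = (-π * v ^ 2 / t : ℝ) := by
    push_cast
    field
  refine ⟨1 / t ^ (1 / 2 : ℝ) * Real.exp (-π * v ^ 2 / t) * r, by positivity, ?_⟩
  rw [jacobiTheta₂_functional_equation, hbase, hexp, hv, hτ, h]
  push_cast [Complex.ofReal_cpow ht.le]
  norm_num

lemma contDiff_log_jacobiTheta₂ {t : ℝ} (ht : 0 < t) {n : ℕ∞} :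
    ContDiff ℝ n fun v : ℝ => Complex.log (jacobiTheta₂ v (Complex.I * t)) := by
  have hholo : Differentiable ℂ fun z => jacobiTheta₂ z (Complex.I * t) :=
    fun z => differentiableAt_jacobiTheta₂_fst z (by simpa using ht)
  have htheta : ContDiff ℝ n fun v : ℝ => jacobiTheta₂ v (Complex.I * t) :=
    (hholo.contDiff.restrict_scalars ℝ).comp Complex.ofRealCLM.contDiff
  refine contDiff_iff_contDiffAt.2 fun v => ?_
  obtain ⟨r, hr, h⟩ := exists_pos_jacobiTheta₂_ofReal ht v
  refine ((Complex.contDiffAt_log ?_).restrict_scalars ℝ).comp v htheta.contDiffAt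
  rw [h]
  exact Complex.ofReal_mem_slitPlane.2 hr

lemma jacobiTheta₂_sub_int (z τ : ℂ) (n : ℤ) : jacobiTheta₂ (z - n) τ = jacobiTheta₂ z τ := by
  have hperiodic : Function.Periodic (fun z => jacobiTheta₂ z τ) 1 := fun z =>
    jacobiTheta₂_add_left z τ
  simpa using hperiodic.sub_int_mul_eq (x := z) n

lemma theta_eq_jacobiTheta₂ (c a : ℝ) (z : ℂ) : theta c a z
    = jacobiTheta₂ (z / (2 * π * Complex.I)) (tauTilde c a / (2 * π * Complex.I)) := by
  have hpi : (π : ℂ) ≠ 0 := Complex.ofReal_ne_zero.2 Real.pi_ne_zero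
  refine tsum_congr fun n => ?_
  rw [jacobiTheta₂_term]
  congr 1
  field_simp [Complex.I_ne_zero]
  ring

lemma tauTilde_div_eq_tauRH {c ξ m : ℝ} (hc : 0 < c) (hm : m ∈ Ioo 0 1)
    (ham : aFun c ξ ^ 2 = c ^ 2 * m) :
    tauTilde c (aFun c ξ) / (2 * π * Complex.I) = tauRH c ξ := by
  have hpi : (π : ℂ) ≠ 0 := Complex.ofReal_ne_zero.2 Real.pi_ne_zero
  rw [tauTilde_eq hc hm ham, tauRH_eq hc hm ham, div_eq_iff (by simp [hpi])]
  push_cast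
  linear_combination (-2 * π * (ellK (1 - m) / ellK m) : ℂ) * Complex.I_sq

/-! ### The Jacobi inversion problem -/

/-- The Abel map along the gap, normalized so that the gap has length one. -/
def gapCoord (c a l : ℝ) : ℝ :=
  (∫ u in (-a ^ 2)..l, (absR c a u)⁻¹) / ∫ u in (-a ^ 2)..0, (absR c a u)⁻¹

section Gap

variable {c a m l : ℝ}

lemma absR_pos_of_mem_gap (hac : a ^ 2 ≤ c ^ 2) (hl : l ∈ Ioo (-a ^ 2) 0) : 0 < absR c a l := by
  have h1 : 0 < l + a ^ 2 := by linarith [hl.1]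
  have h2 : 0 < l + c ^ 2 := by linarith
  exact Real.sqrt_pos.2 (abs_pos.2 (mul_ne_zero (mul_ne_zero hl.2.ne h2.ne') h1.ne'))

lemma integral_gap_inv_absR_pos (hc : 0 < c) (hm : m ∈ Ioo 0 1) (ham : a ^ 2 = c ^ 2 * m) :
    0 < ∫ u in (-a ^ 2)..0, (absR c a u)⁻¹ := by
  have := ellK_pos hm.2
  rw [integral_gap_inv_absR hc hm ham]
  positivity

lemma intervalIntegrable_gap_inv_absR (hc : 0 < c) (hm : m ∈ Ioo 0 1) (ham : a ^ 2 = c ^ 2 * m) :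
    IntervalIntegrable (fun l => (absR c a l)⁻¹) volume (-a ^ 2) 0 :=
  not_imp_comm.1 intervalIntegral.integral_undef (integral_gap_inv_absR_pos hc hm ham).ne'

lemma gapCoord_left : gapCoord c a (-a ^ 2) = 0 := by
  rw [gapCoord, intervalIntegral.integral_same, zero_div]

lemma gapCoord_right (hc : 0 < c) (hm : m ∈ Ioo 0 1) (ham : a ^ 2 = c ^ 2 * m) :
    gapCoord c a 0 = 1 :=
  div_self (integral_gap_inv_absR_pos hc hm ham).ne'

lemma continuousOn_gapCoord (hc : 0 < c) (hm : m ∈ Ioo 0 1) (ham : a ^ 2 = c ^ 2 * m) :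
    ContinuousOn (gapCoord c a) (Icc (-a ^ 2) 0) := by
  have hprim := intervalIntegral.continuousOn_primitive_interval'
    (intervalIntegrable_gap_inv_absR hc hm ham) left_mem_uIcc
  rw [uIcc_of_le (neg_sq_nonpos a)] at hprim
  exact hprim.div_const _

lemma strictMonoOn_gapCoord (hc : 0 < c) (hm : m ∈ Ioo 0 1) (ham : a ^ 2 = c ^ 2 * m) :
    StrictMonoOn (gapCoord c a) (Icc (-a ^ 2) 0) := by
  intro x hx y hy hxy
  have hsub {u v : ℝ} (hu : u ∈ Icc (-a ^ 2) 0) (hv : v ∈ Icc (-a ^ 2) 0) :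
      IntervalIntegrable (fun l => (absR c a l)⁻¹) volume u v :=
    (intervalIntegrable_gap_inv_absR hc hm ham).mono_set
      (by rw [uIcc_of_le (neg_sq_nonpos a)]; exact uIcc_subset_Icc hu hv)
  have hleft := left_mem_Icc.2 (neg_sq_nonpos a)
  have hincr : 0 < ∫ u in x..y, (absR c a u)⁻¹ :=
    intervalIntegral.intervalIntegral_pos_of_pos_on (hsub hx hy)
      (fun u hu => inv_pos.2 (absR_pos_of_mem_gap (sq_le_sq_of_eq_mul hm.2.le ham)
        ⟨hx.1.trans_lt hu.1, hu.2.trans_le hy.2⟩)) hxy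
  refine div_lt_div_of_pos_right ?_ (integral_gap_inv_absR_pos hc hm ham)
  rw [← intervalIntegral.integral_add_adjacent_intervals (hsub hleft hx) (hsub hx hy)]
  exact lt_add_of_pos_right _ hincr

lemma bijOn_gapCoord (hc : 0 < c) (hm : m ∈ Ioo 0 1) (ham : a ^ 2 = c ^ 2 * m) :
    BijOn (gapCoord c a) (Icc (-a ^ 2) 0) (Icc 0 1) := by
  have hmono := strictMonoOn_gapCoord hc hm ham
  have hleft := left_mem_Icc.2 (neg_sq_nonpos a)
  have hright := right_mem_Icc.2 (neg_sq_nonpos a)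
  have hsurj := intermediate_value_Icc (neg_sq_nonpos a) (continuousOn_gapCoord hc hm ham)
  rw [gapCoord_left, gapCoord_right hc hm ham] at hsurj
  refine ⟨fun l hl => ?_, hmono.injOn, hsurj⟩
  rw [← gapCoord_left (c := c) (a := a), ← gapCoord_right hc hm ham]
  exact ⟨hmono.monotoneOn hleft hl hl.1, hmono.monotoneOn hl hright hl.2⟩

lemma integral_normConst_div_curveR (hc : 0 < c) (hm : m ∈ Ioo 0 1) (ham : a ^ 2 = c ^ 2 * m)
    (hl : l ∈ Icc (-a ^ 2) 0) :
    ∫ u in (-a ^ 2)..l, normConst c a / curveR c a u = -(π * gapCoord c a l * Complex.I) := by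
  have hK := ofReal_ellK_ne_zero hm.2
  have hc' : (c : ℂ) ≠ 0 := Complex.ofReal_ne_zero.2 hc.ne'
  have hgap := integral_div_curveR_gap (sq_le_sq_of_eq_mul hm.2.le ham)
    (f := fun _ => normConst c a) (k := normConst c a) (g := fun _ => 1) (by simp) hl
  simp only [one_div] at hgap
  rw [hgap, normConst_eq hc hm ham, gapCoord, integral_gap_inv_absR hc hm ham]
  push_cast
  field

end Gap

section Sheets

variable {c a m l : ℝ}

lemma sqrtCut_sq (z : ℂ) : sqrtCut z ^ 2 = z := by
  have h : (z ^ (1 / 2 : ℂ)) ^ 2 = z := by simp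
  rw [sqrtCut]
  split_ifs
  · exact h
  · rw [neg_sq, h]

lemma curveR_sq (c a : ℝ) (z : ℂ) :
    curveR c a z ^ 2 = z * (z + (c : ℂ) ^ 2) * (z + (a : ℂ) ^ 2) := by
  rw [curveR, mul_pow, mul_pow, sqrtCut_sq, sqrtCut_sq, sqrtCut_sq]

/-- The point of the upper sheet over `z`; over a cut, the boundary value from above. -/
def Surface.upper (c a : ℝ) (z : ℂ) : Surface c a := ⟨(z, curveR c a z), curveR_sq c a z⟩

/-- The point of the lower sheet over `z`; over a cut, the boundary value from above. -/
def Surface.lower (c a : ℝ) (z : ℂ) : Surface c a :=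
  ⟨(z, -curveR c a z), (neg_sq _).trans (curveR_sq c a z)⟩

lemma Surface.eq_upper_or_eq_lower (p : Surface c a) :
    p = upper c a p.proj ∨ p = lower c a p.proj :=
  (sq_eq_sq_iff_eq_or_eq_neg.1 (p.2.trans (curveR_sq c a p.proj).symm)).imp
    (fun h => Subtype.ext (Prod.ext rfl h)) (fun h => Subtype.ext (Prod.ext rfl h))

lemma curveR_ne_zero_of_mem_gap (hac : a ^ 2 ≤ c ^ 2) (hl : l ∈ Ioo (-a ^ 2) 0) :
    curveR c a l ≠ 0 := by
  rw [curveR_gap hac (Ioo_subset_Icc_self hl)]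
  exact mul_ne_zero Complex.I_ne_zero
    (Complex.ofReal_ne_zero.2 (absR_pos_of_mem_gap hac hl).ne')

lemma curveR_eq_zero_of_eq_branchPoint (h : l = -a ^ 2 ∨ l = 0) : curveR c a l = 0 := by
  rw [← sq_eq_zero_iff, curveR_sq]
  rcases h with rfl | rfl <;> simp

lemma Surface.inGap_iff {p : Surface c a} : p.InGap ↔
    (∃ l ∈ Icc (-a ^ 2) 0, p = upper c a (l : ℝ)) ∨
      ∃ l ∈ Ioo (-a ^ 2) 0, p = lower c a (l : ℝ) := by
  constructor
  · rintro ⟨l, hl, hpl⟩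
    rcases p.eq_upper_or_eq_lower with h | h <;> rw [hpl] at h
    · exact .inl ⟨l, hl, h⟩
    by_cases hl' : l ∈ Ioo (-a ^ 2) 0
    · exact .inr ⟨l, hl', h⟩
    · have hbranch : l = -a ^ 2 ∨ l = 0 := by
        contrapose! hl'
        exact ⟨hl.1.lt_of_ne' hl'.1, hl.2.lt_of_ne hl'.2⟩
      refine .inl ⟨l, hl, h.trans (Subtype.ext (Prod.ext rfl ?_))⟩
      simp [upper, lower, curveR_eq_zero_of_eq_branchPoint hbranch]
  · rintro (⟨l, hl, rfl⟩ | ⟨l, hl, rfl⟩)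
    · exact ⟨l, hl, rfl⟩
    · exact ⟨l, Ioo_subset_Icc_self hl, rfl⟩

open Classical in
/-- The normalized Abel map along the gap with the sign of the sheet; it identifies the circle over
the gap with `(-1, 1]`. -/
def signedGapCoord (p : Surface c a) : ℝ :=
  if p.1.2 = curveR c a p.proj then gapCoord c a p.proj.re else -gapCoord c a p.proj.re

lemma signedGapCoord_upper (c a l : ℝ) :
    signedGapCoord (Surface.upper c a l) = gapCoord c a l :=
  if_pos rfl

lemma signedGapCoord_lower (hac : a ^ 2 ≤ c ^ 2) (hl : l ∈ Ioo (-a ^ 2) 0) :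
    signedGapCoord (Surface.lower c a l) = -gapCoord c a l :=
  if_neg fun h => curveR_ne_zero_of_mem_gap hac hl (neg_eq_self.1 h)

lemma gapIntegral_eq (hc : 0 < c) (hm : m ∈ Ioo 0 1) (ham : a ^ 2 = c ^ 2 * m)
    {p : Surface c a} (hp : p.InGap) :
    gapIntegral p = -(π * signedGapCoord p * Complex.I) := by
  obtain ⟨l, hl, hpl⟩ := hp
  have hintegral := integral_normConst_div_curveR hc hm ham hl
  rw [gapIntegral, signedGapCoord, hpl, Complex.ofReal_re]
  split_ifs
  · exact hintegral
  · simp_rw [div_neg, intervalIntegral.integral_neg]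
    rw [hintegral]
    push_cast
    ring

lemma gapCoord_mem_Ioo (hc : 0 < c) (hm : m ∈ Ioo 0 1) (ham : a ^ 2 = c ^ 2 * m)
    (hl : l ∈ Ioo (-a ^ 2) 0) : gapCoord c a l ∈ Ioo 0 1 := by
  have hmono := strictMonoOn_gapCoord hc hm ham
  have hl' := Ioo_subset_Icc_self hl
  rw [← gapCoord_left (c := c) (a := a), ← gapCoord_right hc hm ham]
  exact ⟨hmono (left_mem_Icc.2 (neg_sq_nonpos a)) hl' hl.1,
    hmono hl' (right_mem_Icc.2 (neg_sq_nonpos a)) hl.2⟩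

lemma mapsTo_signedGapCoord (hc : 0 < c) (hm : m ∈ Ioo 0 1) (ham : a ^ 2 = c ^ 2 * m) :
    MapsTo signedGapCoord {p : Surface c a | p.InGap} (Ioc (-1) 1) := by
  intro p hp
  rcases Surface.inGap_iff.1 hp with ⟨l, hl, rfl⟩ | ⟨l, hl, rfl⟩
  · rw [signedGapCoord_upper]
    have := (bijOn_gapCoord hc hm ham).mapsTo hl
    exact ⟨by linarith [this.1], this.2⟩
  · rw [signedGapCoord_lower (sq_le_sq_of_eq_mul hm.2.le ham) hl]
    have := gapCoord_mem_Ioo hc hm ham hl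
    exact ⟨by linarith [this.2], by linarith [this.1]⟩

lemma injOn_signedGapCoord (hc : 0 < c) (hm : m ∈ Ioo 0 1) (ham : a ^ 2 = c ^ 2 * m) :
    InjOn signedGapCoord {p : Surface c a | p.InGap} := by
  have hac := sq_le_sq_of_eq_mul hm.2.le ham
  have hinj := (bijOn_gapCoord hc hm ham).injOn
  have hne {l l' : ℝ} (hl : l ∈ Icc (-a ^ 2) 0) (hl' : l' ∈ Ioo (-a ^ 2) 0) :
      gapCoord c a l ≠ -gapCoord c a l' := fun h => by
    linarith [((bijOn_gapCoord hc hm ham).mapsTo hl).1, (gapCoord_mem_Ioo hc hm ham hl').1]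
  intro p hp q hq hpq
  rcases Surface.inGap_iff.1 hp with ⟨l, hl, rfl⟩ | ⟨l, hl, rfl⟩ <;>
  rcases Surface.inGap_iff.1 hq with ⟨l', hl', rfl⟩ | ⟨l', hl', rfl⟩ <;>
  simp only [signedGapCoord_upper, signedGapCoord_lower hac, hl, hl', neg_inj] at hpq
  · rw [hinj hl hl' hpq]
  · exact absurd hpq (hne hl hl')
  · exact absurd hpq.symm (hne hl' hl)
  · rw [hinj (Ioo_subset_Icc_self hl) (Ioo_subset_Icc_self hl') hpq]

lemma surjOn_signedGapCoord (hc : 0 < c) (hm : m ∈ Ioo 0 1) (ham : a ^ 2 = c ^ 2 * m) :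
    SurjOn signedGapCoord {p : Surface c a | p.InGap} (Ioc (-1) 1) := by
  have hsurj := (bijOn_gapCoord hc hm ham).surjOn
  intro σ hσ
  rcases le_or_gt 0 σ with h | h
  · obtain ⟨l, hl, rfl⟩ := hsurj ⟨h, hσ.2⟩
    exact ⟨_, Surface.inGap_iff.2 (.inl ⟨l, hl, rfl⟩), signedGapCoord_upper c a l⟩
  · obtain ⟨l, hl, hlσ⟩ := hsurj (show -σ ∈ Icc 0 1 from ⟨by linarith, by linarith [hσ.1]⟩)
    have hl' : l ∈ Ioo (-a ^ 2) 0 := by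
      refine ⟨hl.1.lt_of_ne ?_, hl.2.lt_of_ne ?_⟩ <;> rintro rfl
      · rw [gapCoord_left] at hlσ
        linarith
      · rw [gapCoord_right hc hm ham] at hlσ
        linarith [hσ.1]
    refine ⟨_, Surface.inGap_iff.2 (.inr ⟨l, hl', rfl⟩), ?_⟩
    rw [signedGapCoord_lower (sq_le_sq_of_eq_mul hm.2.le ham) hl', hlσ, neg_neg]

/-- The point `p` solves the Jacobi inversion problem `∫_{-a²}^p dω ≡ -iΔ (mod 2πi)`, for an
arbitrary real phase shift `Δ`. -/
def IsJacobiPoint (Δ : ℝ) (p : Surface c a) : Prop :=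
  p.InGap ∧ ∃ n : ℤ, gapIntegral p = -(Complex.I * Δ) + 2 * π * Complex.I * n

lemma isJacobiPoint_iff (hc : 0 < c) (hm : m ∈ Ioo 0 1) (ham : a ^ 2 = c ^ 2 * m) {Δ : ℝ}
    {p : Surface c a} :
    IsJacobiPoint Δ p ↔ p.InGap ∧ ∃ n : ℤ, signedGapCoord p = Δ / π + n • 2 := by
  refine and_congr_right fun hp => (Equiv.neg ℤ).exists_congr fun n => ?_
  have hpi : (π : ℂ) ≠ 0 := Complex.ofReal_ne_zero.2 Real.pi_ne_zero
  have hdiff : gapIntegral p - (-(Complex.I * Δ) + 2 * π * Complex.I * n)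
      = -(π * Complex.I) * ((signedGapCoord p : ℝ) - (Δ / π + Equiv.neg ℤ n • 2 : ℝ)) := by
    rw [gapIntegral_eq hc hm ham hp]
    push_cast [Equiv.neg_apply, zsmul_eq_mul]
    field
  rw [← sub_eq_zero, hdiff, mul_eq_zero_iff_left (by simp [hpi]), sub_eq_zero, Complex.ofReal_inj]

theorem existsUnique_isJacobiPoint (hc : 0 < c) (hm : m ∈ Ioo 0 1) (ham : a ^ 2 = c ^ 2 * m)
    (Δ : ℝ) : ∃! p : Surface c a, IsJacobiPoint Δ p := by
  obtain ⟨n, hn, hunique⟩ := existsUnique_add_zsmul_mem_Ioc two_pos (Δ / π) (-1)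
  rw [show (-1 + 2 : ℝ) = 1 by norm_num] at hn hunique
  simp only [isJacobiPoint_iff hc hm ham]
  obtain ⟨p, hp, hpn⟩ := surjOn_signedGapCoord hc hm ham hn
  refine ⟨p, ⟨hp, n, hpn⟩, fun q ⟨hq, k, hqk⟩ => injOn_signedGapCoord hc hm ham hq hp ?_⟩
  rw [hqk, hpn, hunique k (by simpa only [hqk] using mapsTo_signedGapCoord hc hm ham hq)]

end Sheets

/-! ### Comparison of the two formulas -/

lemma phase_eq_phaseB {c ξ ν₁ ν₂ : ℝ} (hc : 0 < c) (hξ : ξ ∈ Ioo (-c ^ 2 / 2) (c ^ 2 / 3))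
    (hν : IsNuPair c (aFun c ξ) ν₁ ν₂) :
    12 * ξ * waveNumber c (aFun c ξ) - 4 * frequency c (aFun c ξ) ν₁ ν₂ = phaseB c ξ := by
  have hm := ellParam_mem_Ioo hc hξ
  have hK := ofReal_ellK_ne_zero hm.2
  rw [waveNumber_eq hc hm (aFun_sq hc.ne'), frequency_eq hc hm (aFun_sq hc.ne') hν,
    phaseB_eq hc hξ rfl]
  push_cast
  field

/-- The logarithm of `θ₃` along the real axis, as in `logThetaRH` but with an arbitrary phase shift
`Δ(ξ)` in place of the one determined by the scattering data. -/
def logThetaPhase (c : ℝ) (Δ : ℝ → ℝ) (ξ t v : ℝ) : ℂ :=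
  Complex.log (jacobiTheta₂ (((t * phaseB c ξ + Δ ξ) / (2 * π) + v : ℝ) : ℂ) (tauRH c ξ))

/-- The modulated elliptic wave, as in `qRH` but with an arbitrary phase shift `Δ(ξ)` in place of
the one determined by the scattering data. -/
def ellipticProfile (c : ℝ) (Δ : ℝ → ℝ) (x t : ℝ) : ℂ :=
  ((gammaRH c (x / (12 * t)) * deriv (phaseB c) (x / (12 * t)) / (6 * π) : ℝ) : ℂ)
      * iteratedDeriv 2 (logThetaPhase c Δ (x / (12 * t)) t) 0
    - ((deriv (zRH c) (x / (12 * t)) / 6 : ℝ) : ℂ)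

lemma contDiff_logThetaPhase {c ξ : ℝ} (hc : 0 < c) (hξ : ξ ∈ Ioo (-c ^ 2 / 2) (c ^ 2 / 3))
    (Δ : ℝ → ℝ) (t : ℝ) {n : ℕ∞} : ContDiff ℝ n (logThetaPhase c Δ ξ t) := by
  have hm := ellParam_mem_Ioo hc hξ
  have hτ := div_pos (ellK_pos (show 1 - ellParam c ξ < 1 by linarith [hm.1])) (ellK_pos hm.2)
  have h := contDiff_log_jacobiTheta₂ (n := n) hτ
  rw [← tauRH_eq hc hm (aFun_sq hc.ne')] at h
  exact h.comp (contDiff_const.add contDiff_id)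

section

variable {c ξ ν₁ ν₂ x t : ℝ} {Δ : ℝ → ℝ} {p₀ : Surface c (aFun c ξ)}

lemma logThetaIM_eq (hc : 0 < c) (hξ : ξ ∈ Ioo (-c ^ 2 / 2) (c ^ 2 / 3))
    (hν : IsNuPair c (aFun c ξ) ν₁ ν₂) (hp : IsJacobiPoint (Δ ξ) p₀) (hx : x = 12 * t * ξ) :
    logThetaIM c (aFun c ξ) ν₁ ν₂ p₀ t
      = fun y => logThetaPhase c Δ ξ t (c / (2 * ellK (ellParam c ξ)) * (y - x)) := by
  obtain ⟨-, n, hn⟩ := hp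
  have hm := ellParam_mem_Ioo hc hξ
  have hpi : (π : ℂ) ≠ 0 := Complex.ofReal_ne_zero.2 Real.pi_ne_zero
  have hK := ofReal_ellK_ne_zero hm.2
  have hA := abelMap_add_riemannConst hc hm (aFun_sq hc.ne') p₀
  have hB := phase_eq_phaseB hc hξ hν
  have hV := waveNumber_eq hc hm (aFun_sq hc.ne')
  rw [hn] at hA
  funext y
  rw [logThetaIM, logThetaPhase, theta_eq_jacobiTheta₂,
    tauTilde_div_eq_tauRH hc hm (aFun_sq hc.ne'), ← jacobiTheta₂_sub_int _ _ (-(n + 1))]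
  congr 2
  rw [hV] at hB ⊢
  push_cast
  rw [← hB, hx]
  push_cast
  field_simp [Complex.I_ne_zero]
  linear_combination -(ellK (ellParam c ξ) : ℂ) * hA

lemma contDiff_logThetaIM (hc : 0 < c) (hξ : ξ ∈ Ioo (-c ^ 2 / 2) (c ^ 2 / 3))
    (hν : IsNuPair c (aFun c ξ) ν₁ ν₂) (hp : IsJacobiPoint (Δ ξ) p₀) {n : ℕ∞} :
    ContDiff ℝ n (logThetaIM c (aFun c ξ) ν₁ ν₂ p₀ t) := by
  rw [logThetaIM_eq hc hξ hν hp rfl]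
  exact (contDiff_logThetaPhase hc hξ Δ t).comp (by fun_prop)

lemma iteratedDeriv_two_logThetaIM (hc : 0 < c) (hξ : ξ ∈ Ioo (-c ^ 2 / 2) (c ^ 2 / 3))
    (hν : IsNuPair c (aFun c ξ) ν₁ ν₂) (hp : IsJacobiPoint (Δ ξ) p₀) (hx : x = 12 * t * ξ) :
    iteratedDeriv 2 (logThetaIM c (aFun c ξ) ν₁ ν₂ p₀ t) x
      = ((c / (2 * ellK (ellParam c ξ))) ^ 2 : ℝ)
        * iteratedDeriv 2 (logThetaPhase c Δ ξ t) 0 := by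
  rw [logThetaIM_eq hc hξ hν hp hx, iteratedDeriv_comp_sub_const 2 (fun y =>
      logThetaPhase c Δ ξ t (c / (2 * ellK (ellParam c ξ)) * y)),
    iteratedDeriv_comp_const_smul (contDiff_logThetaPhase hc hξ Δ t (n := 2))]
  simp only [sub_self, mul_zero, Complex.real_smul]

theorem ellipticProfile_eq_qIM (hc : 0 < c) (hξ : ξ ∈ Ioo (-c ^ 2 / 2) (c ^ 2 / 3))
    (hν : IsNuPair c (aFun c ξ) ν₁ ν₂) (hp : IsJacobiPoint (Δ ξ) p₀) (ht : t ≠ 0)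
    (hxt : x / (12 * t) = ξ) :
    ellipticProfile c Δ x t = qIM c (aFun c ξ) ν₁ ν₂ p₀ x t := by
  have hx : x = 12 * t * ξ := by
    rw [← hxt]
    field
  have hm := ellParam_mem_Ioo hc hξ
  have hK := ofReal_ellK_ne_zero hm.2
  have hpi : (π : ℂ) ≠ 0 := Complex.ofReal_ne_zero.2 Real.pi_ne_zero
  have hcc : (c : ℂ) ≠ 0 := Complex.ofReal_ne_zero.2 hc.ne'
  have hasq : (aFun c ξ : ℂ) ^ 2 = (c : ℂ) ^ 2 * ellParam c ξ := by
    exact_mod_cast aFun_sq hc.ne'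
  rw [ellipticProfile, qIM, hxt, iteratedDeriv_two_logThetaIM hc hξ hν hp hx,
    (hasDerivAt_phaseB hc hξ rfl).deriv, (hasDerivAt_zRH hc hξ rfl).deriv, gammaRH,
    gapInt_eq hc hξ, hConst_eq hc hm (aFun_sq hc.ne'), hasq]
  push_cast
  field

end

theorem mainTheorem1_general {c ξ : ℝ} (hc : 0 < c) (hξ : ξ ∈ Ioo (-c ^ 2 / 2) (c ^ 2 / 3))
    (Δ : ℝ → ℝ) :
    (∃! a : ℝ, IsBranchParam c ξ a) ∧ DifferentiableAt ℝ (phaseB c) ξ ∧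
    DifferentiableAt ℝ (zRH c) ξ ∧ (∃ ν₁ ν₂ : ℝ, IsNuPair c (aFun c ξ) ν₁ ν₂) ∧
    (∃! p₀ : Surface c (aFun c ξ), IsJacobiPoint (Δ ξ) p₀) ∧
    ∀ (ν₁ ν₂ : ℝ) (p₀ : Surface c (aFun c ξ)),
      IsNuPair c (aFun c ξ) ν₁ ν₂ → IsJacobiPoint (Δ ξ) p₀ →
      ∀ x t : ℝ, t ≠ 0 → x / (12 * t) = ξ →
        ContDiff ℝ 2 (logThetaPhase c Δ ξ t) ∧
        ContDiff ℝ 2 (logThetaIM c (aFun c ξ) ν₁ ν₂ p₀ t) ∧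
        ellipticProfile c Δ x t = qIM c (aFun c ξ) ν₁ ν₂ p₀ x t := by
  have hm := ellParam_mem_Ioo hc hξ
  refine ⟨existsUnique_isBranchParam hc hξ, (hasDerivAt_phaseB hc hξ rfl).differentiableAt,
    (hasDerivAt_zRH hc hξ rfl).differentiableAt, exists_isNuPair hc hm (aFun_sq hc.ne'),
    existsUnique_isJacobiPoint hc hm (aFun_sq hc.ne') (Δ ξ), ?_⟩
  intro ν₁ ν₂ p₀ hν hp x t ht hxt
  exact ⟨contDiff_logThetaPhase hc hξ Δ t, contDiff_logThetaIM hc hξ hν hp,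
    ellipticProfile_eq_qIM hc hξ hν hp ht hxt⟩

end KdVShock

end

theorem mainTheorem1 (c C₀ : ℝ) (hc : 0 < c) (hC₀ : c < C₀) (q₀ : ℝ → ℝ)
    (hmeas : MeasureTheory.AEStronglyMeasurable q₀ MeasureTheory.volume)
    (hdecay : MeasureTheory.IntegrableOn
      (fun x : ℝ => Real.exp (C₀ * x) * (|q₀ x| + |q₀ (-x) + c ^ 2|)) (Set.Ioi 0))
    (ξ : ℝ) (hξ : ξ ∈ Set.Ioo (-c ^ 2 / 2) (c ^ 2 / 3)) :
    -- the data entering the two formulas are well defined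
    (∃! a : ℝ, KdVShock.IsBranchParam c ξ a) ∧
    DifferentiableAt ℝ (KdVShock.phaseB c) ξ ∧
    DifferentiableAt ℝ (KdVShock.zRH c) ξ ∧
    (∃ ν₁ ν₂ : ℝ, KdVShock.IsNuPair c (KdVShock.aFun c ξ) ν₁ ν₂) ∧
    -- the Jacobi inversion problem is uniquely solvable
    (∃! p₀ : KdVShock.Surface c (KdVShock.aFun c ξ), KdVShock.SolvesJacobi c q₀ ξ p₀) ∧
    -- the profile is the one-gap solution with the Dirichlet divisor so determined
    ∀ (ν₁ ν₂ : ℝ) (p₀ : KdVShock.Surface c (KdVShock.aFun c ξ)),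
      KdVShock.IsNuPair c (KdVShock.aFun c ξ) ν₁ ν₂ →
      KdVShock.SolvesJacobi c q₀ ξ p₀ →
      ∀ x t : ℝ, t ≠ 0 → x / (12 * t) = ξ →
        ContDiff ℝ 2 (KdVShock.logThetaRH c q₀ ξ t) ∧
        ContDiff ℝ 2 (KdVShock.logThetaIM c (KdVShock.aFun c ξ) ν₁ ν₂ p₀ t) ∧
        KdVShock.qRH c q₀ x t = KdVShock.qIM c (KdVShock.aFun c ξ) ν₁ ν₂ p₀ x t :=
  KdVShock.mainTheorem1_general hc hξ (KdVShock.deltaRH c q₀)
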